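/- Let $M$ be a smooth manifold of dimension $n$ with a Riemannian metric $\hat g$, Levi-Civita connection $\widehat\nabla$ and scalar curvature $S(\hat g)$. Let $\bar g$ be the Euclidean metric of $\mathbb{R}^n$. A conformal chart is a smooth chart $\varphi : U \to \mathbb{R}^n$ of $M$ such that $\hat g = e^{2u}\varphi^*\bar g$ on $U$ for a smooth function $u$; $\hat g$ is locally conformally flat if each point of $M$ lies in the domain of a conformal chart. For such a chart put $$\mathrm{OS}(\hat g,\varphi^*\bar g) = \mathrm{Hess}(u) - du\otimes du - \tfrac1n\left(\Delta u - |\nabla u|^2\right)\varphi^*\bar g,$$ with $\mathrm{Hess}$, $\Delta$, $\nabla u$ and $|\cdot|$ taken with respect to $\varphi^*\bar g$. (i) Let $n\ge 3$ and let $\hat g$ be locally conformally flat. Let $\mathrm{OS}(\hat g)$ be the tensor on $M$ that equals $\mathrm{OS}(\hat g,\varphi^*\bar g)$ on the domain of each conformal chart $\varphi$. If $\hat B$ is the field of endomorphisms of $TM$ with $$\hat g(\hat B X, Y) = 2\,\mathrm{OS}(\hat g)(X,Y) - \frac{S(\hat g)}{n(n-1)}\,\hat g(X,Y) \quad\text{for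 all } X, Y,$$ then $\hat B$ is differentiable and $(\hat g,\hat B)$ solves the Codazzi equation at infinity $d^{\widehat\nabla}\hat B = 0$, that is, $\widehat\nabla_X(\hat BY) - \widehat\nabla_Y(\hat BX) - \hat B[X,Y] = 0$ for all vector fields $X, Y$. (ii) The same holds for $n=2$ once a complex projective structure compatible with $\hat g$ is chosen, that is, an atlas of conformal charts to $\mathbb{R}^2=\mathbb{C}$ whose transition maps are locally restrictions of Möbius transformations $z\mapsto (az+b)/(cz+d)$, with $\mathrm{OS}(\hat g)$ the tensor that equals $\mathrm{OS}(\hat g,\varphi^*\bar g)$ on the domain of each chart $\varphi$ of that atlas. -/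

import Mathlib

open scoped Manifold ContDiff Bundle Topology

namespace ConformallyFlat

section Geometry

variable {E : Type*} [NormedAddCommGroup E] [NormedSpace ℝ E] [FiniteDimensional ℝ E]
  {H : Type*} [TopologicalSpace H] (I : ModelWithCorners ℝ E H)
  {M : Type*} [TopologicalSpace M] [ChartedSpace H M] [IsManifold I ∞ M]
  [Bundle.RiemannianBundle (fun x : M ↦ TangentSpace I x)]
  [IsContMDiffRiemannianBundle I ∞ E (fun x : M ↦ TangentSpace I x)]

/-- The Koszul expression: for the Levi-Civita connection it equals `2 g(∇_X Y, Z)`. -/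
noncomputable def koszul (X Y Z : Π x : M, TangentSpace I x) (x : M) : ℝ :=
  mvfderiv I (fun y ↦ inner ℝ (Y y) (Z y)) x (X x)
    + mvfderiv I (fun y ↦ inner ℝ (X y) (Z y)) x (Y x)
    - mvfderiv I (fun y ↦ inner ℝ (X y) (Y y)) x (Z x)
    + inner ℝ (VectorField.mlieBracket I X Y x) (Z x)
    - inner ℝ (VectorField.mlieBracket I X Z x) (Y x)
    - inner ℝ (VectorField.mlieBracket I Y Z x) (X x)

instance instFiniteDimensionalTangentSpace (x : M) : FiniteDimensional ℝ (TangentSpace I x) := inferInstanceAs (FiniteDimensional ℝ E)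

theorem mdifferentiableAt_inner {X Y : Π x : M, TangentSpace I x} {x : M}
    (hX : MDiffAt (T% X) x) (hY : MDiffAt (T% Y) x) :
    MDiffAt (fun y ↦ inner ℝ (X y) (Y y)) x :=
  MDifferentiableAt.inner_bundle (E := fun x : M ↦ TangentSpace I x) (F := E) (b := fun y => y) hX hY

theorem koszul_tensorial_left (Y Z : Π x : M, TangentSpace I x) (x : M)
    (hY : MDiffAt (T% Y) x) (hZ : MDiffAt (T% Z) x) :
    TensorialAt I E (koszul I · Y Z x) x where
  smul {f X} hf hX := by
    have h1 : (fun y ↦ inner ℝ ((f • X) y) (Z y)) = f * (fun y ↦ inner ℝ (X y) (Z y)) := by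
      ext y; simp [inner_smul_left]
    have h2 : (fun y ↦ inner ℝ ((f • X) y) (Y y)) = f * (fun y ↦ inner ℝ (X y) (Y y)) := by
      ext y; simp [inner_smul_left]
    simp only [koszul, h1, h2]
    rw [mvfderiv_mul hf (mdifferentiableAt_inner I hX hZ), mvfderiv_mul hf (mdifferentiableAt_inner I hX hY),
      VectorField.mlieBracket_smul_left hf hX, VectorField.mlieBracket_smul_left hf hX]
    simp [inner_add_left, inner_smul_left, inner_smul_right]
    ring
  add {X X'} hX hX' := by
    have h1 : (fun y ↦ inner ℝ ((X + X') y) (Z y)) = (fun y ↦ inner ℝ (X y) (Z y)) + (fun y ↦ inner ℝ (X' y) (Z y)) := by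
      ext y; simp [inner_add_left]
    have h2 : (fun y ↦ inner ℝ ((X + X') y) (Y y)) = (fun y ↦ inner ℝ (X y) (Y y)) + (fun y ↦ inner ℝ (X' y) (Y y)) := by
      ext y; simp [inner_add_left]
    simp only [koszul, h1, h2]
    rw [mvfderiv_add (mdifferentiableAt_inner I hX hZ) (mdifferentiableAt_inner I hX' hZ), mvfderiv_add (mdifferentiableAt_inner I hX hY) (mdifferentiableAt_inner I hX' hY),
      VectorField.mlieBracket_add_left hX hX', VectorField.mlieBracket_add_left hX hX']
    simp [inner_add_left, inner_add_right]
    ring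

theorem koszul_tensorial_right (X Y : Π x : M, TangentSpace I x) (x : M)
    (hX : MDiffAt (T% X) x) (hY : MDiffAt (T% Y) x) :
    TensorialAt I E (koszul I X Y · x) x where
  smul {f Z} hf hZ := by
    have h1 : (fun y ↦ inner ℝ (X y) ((f • Z) y)) = f * (fun y ↦ inner ℝ (X y) (Z y)) := by
      ext y; simp [inner_smul_right]
    have h2 : (fun y ↦ inner ℝ (Y y) ((f • Z) y)) = f * (fun y ↦ inner ℝ (Y y) (Z y)) := by
      ext y; simp [inner_smul_right]
    simp only [koszul, h1, h2]
    rw [mvfderiv_mul hf (mdifferentiableAt_inner I hX hZ), mvfderiv_mul hf (mdifferentiableAt_inner I hY hZ),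
      VectorField.mlieBracket_smul_right hf hZ, VectorField.mlieBracket_smul_right hf hZ]
    simp [inner_add_left, inner_smul_left, inner_smul_right, real_inner_comm]
    ring
  add {Z Z'} hZ hZ' := by
    have h1 : (fun y ↦ inner ℝ (X y) ((Z + Z') y)) = (fun y ↦ inner ℝ (X y) (Z y)) + (fun y ↦ inner ℝ (X y) (Z' y)) := by
      ext y; simp [inner_add_right]
    have h2 : (fun y ↦ inner ℝ (Y y) ((Z + Z') y)) = (fun y ↦ inner ℝ (Y y) (Z y)) + (fun y ↦ inner ℝ (Y y) (Z' y)) := by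
      ext y; simp [inner_add_right]
    simp only [koszul, h1, h2]
    rw [mvfderiv_add (mdifferentiableAt_inner I hX hZ) (mdifferentiableAt_inner I hX hZ'), mvfderiv_add (mdifferentiableAt_inner I hY hZ) (mdifferentiableAt_inner I hY hZ'),
      VectorField.mlieBracket_add_right hZ hZ', VectorField.mlieBracket_add_right hZ hZ']
    simp [inner_add_left, inner_add_right]
    ring

open scoped Classical in
/-- The operator `Y ↦ (v ↦ ∇_v Y)` determined by the Koszul formula
`2 g(∇_X Y, Z) = koszul X Y Z` (and `0` at points where `Y` is not differentiable). -/
noncomputable def koszulCov (Y : Π x : M, TangentSpace I x) (x : M) :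
    TangentSpace I x →L[ℝ] TangentSpace I x :=
  if hY : MDiffAt (T% Y) x then
    ∑ i, (2⁻¹ : ℝ) • ((TensorialAt.mkHom₂ (fun X Z ↦ koszul I X Y Z x) x
      (fun Z hZ ↦ koszul_tensorial_left I Y Z x hY hZ)
      (fun X hX ↦ koszul_tensorial_right I X Y x hX hY)).flip
        (stdOrthonormalBasis ℝ (TangentSpace I x) i)).smulRight
          (stdOrthonormalBasis ℝ (TangentSpace I x) i)
  else 0

theorem inner_koszulCov {X Y Z : Π x : M, TangentSpace I x} {x : M}
    (hX : MDiffAt (T% X) x) (hY : MDiffAt (T% Y) x) (hZ : MDiffAt (T% Z) x) :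
    inner ℝ (koszulCov I Y x (X x)) (Z x) = 2⁻¹ * koszul I X Y Z x := by
  rw [← TensorialAt.mkHom₂_apply (Φ := fun X Z ↦ koszul I X Y Z x)
      (fun Z hZ ↦ koszul_tensorial_left I Y Z x hY hZ)
      (fun X hX ↦ koszul_tensorial_right I X Y x hX hY) hX hZ]
  simp only [koszulCov, hY, dif_pos]
  set L := TensorialAt.mkHom₂ (fun X Z ↦ koszul I X Y Z x) x
      (fun Z hZ ↦ koszul_tensorial_left I Y Z x hY hZ)
      (fun X hX ↦ koszul_tensorial_right I X Y x hX hY)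
  set b := stdOrthonormalBasis ℝ (TangentSpace I x)
  conv_rhs => rw [← b.sum_repr' (Z x)]
  simp [sum_inner, inner_smul_left, Finset.mul_sum]
  refine Finset.sum_congr rfl fun i _ ↦ ?_
  ring

theorem koszulCov_eq {X Y : Π x : M, TangentSpace I x} {x : M} {v : TangentSpace I x}
    (hX : MDiffAt (T% X) x) (hY : MDiffAt (T% Y) x)
    (h : ∀ Z : Π x : M, TangentSpace I x, MDiffAt (T% Z) x →
      inner ℝ v (Z x) = 2⁻¹ * koszul I X Y Z x) :
    koszulCov I Y x (X x) = v := by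
  refine ext_inner_right ℝ fun z ↦ ?_
  have hZ := FiberBundle.mdifferentiableAt_extend I E z
  have := inner_koszulCov I hX hY hZ
  rw [← h _ hZ] at this
  simpa using this

theorem koszulCov_isCov : IsCovariantDerivativeOn E (koszulCov I (M := M)) where
  add {Y Y'} x hY hY' _ := by
    ext v
    have hX := FiberBundle.mdifferentiableAt_extend I E v
    have key : koszulCov I (Y + Y') x (FiberBundle.extend E v x) =
        koszulCov I Y x (FiberBundle.extend E v x) + koszulCov I Y' x (FiberBundle.extend E v x) := by
      refine koszulCov_eq I hX (mdifferentiableAt_add_section hY hY') fun Z hZ ↦ ?_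
      rw [inner_add_left, inner_koszulCov I hX hY hZ, inner_koszulCov I hX hY' hZ]
      have h1 : (fun y ↦ inner ℝ ((Y + Y') y) (Z y)) = (fun y ↦ inner ℝ (Y y) (Z y)) + (fun y ↦ inner ℝ (Y' y) (Z y)) := by
        ext y; simp [inner_add_left]
      have h2 : (fun y ↦ inner ℝ (FiberBundle.extend E v y) ((Y + Y') y)) = (fun y ↦ inner ℝ (FiberBundle.extend E v y) (Y y)) + (fun y ↦ inner ℝ (FiberBundle.extend E v y) (Y' y)) := by
        ext y; simp [inner_add_right]
      simp only [koszul, h1, h2]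
      rw [mvfderiv_add (mdifferentiableAt_inner I hY hZ) (mdifferentiableAt_inner I hY' hZ), mvfderiv_add (mdifferentiableAt_inner I hX hY) (mdifferentiableAt_inner I hX hY'),
        VectorField.mlieBracket_add_left hY hY', VectorField.mlieBracket_add_right hY hY']
      simp [inner_add_left, inner_add_right]
      ring
    simpa using key
  leibniz {Y f} x hY hf _ := by
    ext v
    have hX := FiberBundle.mdifferentiableAt_extend I E v
    have key : koszulCov I (f • Y) x (FiberBundle.extend E v x) =
        f x • koszulCov I Y x (FiberBundle.extend E v x)
          + mvfderiv I f x (FiberBundle.extend E v x) • Y x := by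
      refine koszulCov_eq I hX (hf.smul_section hY) fun Z hZ ↦ ?_
      rw [inner_add_left, inner_smul_left, inner_koszulCov I hX hY hZ]
      have h1 : (fun y ↦ inner ℝ ((f • Y) y) (Z y)) = f * (fun y ↦ inner ℝ (Y y) (Z y)) := by
        ext y; simp [inner_smul_left]
      have h2 : (fun y ↦ inner ℝ (FiberBundle.extend E v y) ((f • Y) y)) = f * (fun y ↦ inner ℝ (FiberBundle.extend E v y) (Y y)) := by
        ext y; simp [inner_smul_right]
      simp only [koszul, h1, h2]
      rw [mvfderiv_mul hf (mdifferentiableAt_inner I hY hZ), mvfderiv_mul hf (mdifferentiableAt_inner I hX hY),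
        VectorField.mlieBracket_smul_left hf hY, VectorField.mlieBracket_smul_right hf hY]
      simp [inner_add_left, inner_smul_left, inner_smul_right, real_inner_comm]
      ring
    simpa using key

/-- The Levi-Civita connection of the Riemannian metric; `leviCivita I Y x v` is `(∇_v Y)(x)`.
It is torsion free and compatible with the metric, as shown below. -/
noncomputable def leviCivita : CovariantDerivative I E (fun x : M ↦ TangentSpace I x) :=
  ⟨koszulCov I, koszulCov_isCov I⟩

theorem leviCivita_torsion : (leviCivita I (M := M)).torsion = 0 := by
  rw [CovariantDerivative.torsion_eq_zero_iff]
  intro X Y x hX hY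
  refine ext_inner_right ℝ fun z ↦ ?_
  have hZ := FiberBundle.mdifferentiableAt_extend I E z
  have h1 := inner_koszulCov I hX hY hZ
  have h2 := inner_koszulCov I hY hX hZ
  simp only [FiberBundle.extend_apply_self] at h1 h2
  rw [inner_sub_left]
  change inner ℝ (koszulCov I Y x (X x)) z - inner ℝ (koszulCov I X x (Y x)) z = _
  rw [h1, h2]
  have h3 : (fun y ↦ inner ℝ (Y y) (X y)) = (fun y ↦ inner ℝ (X y) (Y y)) := by
    ext y; exact real_inner_comm _ _
  simp only [koszul, h3]
  rw [VectorField.mlieBracket_swap (V := Y) (W := X)]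
  simp
  ring

theorem leviCivita_metric {x : M} {X Y Z : Π x : M, TangentSpace I x}
    (hX : MDiffAt (T% X) x) (hY : MDiffAt (T% Y) x) (hZ : MDiffAt (T% Z) x) :
    mvfderiv I (fun y ↦ inner ℝ (Y y) (Z y)) x (X x) =
      inner ℝ (leviCivita I Y x (X x)) (Z x) + inner ℝ (Y x) (leviCivita I Z x (X x)) := by
  have h1 := inner_koszulCov I hX hY hZ
  have h2 := inner_koszulCov I hX hZ hY
  change _ = inner ℝ (koszulCov I Y x (X x)) (Z x) + inner ℝ (Y x) (koszulCov I Z x (X x))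
  rw [real_inner_comm (koszulCov I Z x (X x)), h1, h2]
  have h3 : (fun y ↦ inner ℝ (Z y) (Y y)) = (fun y ↦ inner ℝ (Y y) (Z y)) := by
    ext y; exact real_inner_comm _ _
  simp only [koszul, h3]
  rw [VectorField.mlieBracket_swap (V := Z) (W := Y)]
  simp
  ring


/-- The exterior covariant derivative `d^∇ B (X, Y) = ∇_X (B Y) - ∇_Y (B X) - B [X, Y]` of a field
of endomorphisms of the tangent bundle. -/
noncomputable def extCovDeriv (B : Π x : M, TangentSpace I x →L[ℝ] TangentSpace I x)
    (X Y : Π x : M, TangentSpace I x) (x : M) : TangentSpace I x :=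
  leviCivita I (fun y ↦ B y (Y y)) x (X x) - leviCivita I (fun y ↦ B y (X y)) x (Y x)
    - B x (VectorField.mlieBracket I X Y x)

/-- The Codazzi equation `d^∇ B = 0`. So that the derivatives in it are meaningful, `B` is required
to be differentiable, that is, to send differentiable vector fields to differentiable ones. -/
def SolvesCodazzi (B : Π x : M, TangentSpace I x →L[ℝ] TangentSpace I x) : Prop :=
  (∀ (x : M) (X : Π x : M, TangentSpace I x), MDiffAt (T% X) x →
    MDiffAt (T% (fun y ↦ B y (X y))) x) ∧
  ∀ (x : M) (X Y : Π x : M, TangentSpace I x), MDiffAt (T% X) x → MDiffAt (T% Y) x →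
    extCovDeriv I B X Y x = 0

/-- `R(X, Y) Z = ∇_X ∇_Y Z - ∇_Y ∇_X Z - ∇_[X, Y] Z`. -/
noncomputable def curvature (X Y Z : Π x : M, TangentSpace I x) (x : M) : TangentSpace I x :=
  leviCivita I (fun y ↦ leviCivita I Z y (Y y)) x (X x)
    - leviCivita I (fun y ↦ leviCivita I Z y (X y)) x (Y x)
    - leviCivita I Z x (VectorField.mlieBracket I X Y x)

/-- The curvature tensor `Rm(a, b, c, d) = g(R(a, b) c, d)` at a point. The tangent vectors are
extended to vector fields that are smooth near `x` (the coordinate fields with constant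
coefficients in the preferred chart at `x`); the value is independent of the extensions. -/
noncomputable def riemann (x : M) (a b c d : TangentSpace I x) : ℝ :=
  inner ℝ (curvature I (FiberBundle.extend E a) (FiberBundle.extend E b)
    (FiberBundle.extend E c) x) d

/-- The trace of a 2-tensor at `x` with respect to the metric. -/
noncomputable def metricTrace (x : M) (T : TangentSpace I x → TangentSpace I x → ℝ) : ℝ :=
  ∑ i, T (stdOrthonormalBasis ℝ (TangentSpace I x) i) (stdOrthonormalBasis ℝ (TangentSpace I x) i)

/-- The Ricci tensor: the trace of `Rm` on its first and last arguments. -/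
noncomputable def ricci (x : M) (b c : TangentSpace I x) : ℝ :=
  metricTrace I x (fun a d ↦ riemann I x a b c d)

/-- The scalar curvature: the trace of the Ricci tensor. -/
noncomputable def scalarCurvature (x : M) : ℝ :=
  metricTrace I x (ricci I x)

/-- The gradient of `u`: the vector field dual to `du`. -/
noncomputable def grad (u : M → ℝ) (x : M) : TangentSpace I x :=
  ∑ i, mvfderiv I u x (stdOrthonormalBasis ℝ (TangentSpace I x) i) •
    stdOrthonormalBasis ℝ (TangentSpace I x) i

/-- The Hessian `Hess(u)(v, w) = g(∇_v ∇u, w)`. -/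
noncomputable def hessian (u : M → ℝ) (x : M) (v w : TangentSpace I x) : ℝ :=
  inner ℝ (leviCivita I (grad I u) x v) w

/-- The Laplacian: the trace of the Hessian. -/
noncomputable def laplacian (u : M → ℝ) (x : M) : ℝ :=
  metricTrace I x (hessian I u x)

/-- The Osgood-Stowe tensor `OS(e^{2u} g, g)`, where `g` is the Riemannian metric:
the traceless part of `Hess(u) - du ⊗ du`. -/
noncomputable def osgoodStowe (u : M → ℝ) (x : M) (v w : TangentSpace I x) : ℝ :=
  hessian I u x v w - mvfderiv I u x v * mvfderiv I u x w
    - 1 / (Module.finrank ℝ E : ℝ) *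
      (laplacian I u x - inner ℝ (grad I u x) (grad I u x)) * inner ℝ v w

end Geometry

section ConformallyFlat

variable (n : ℕ) (M : Type*) [TopologicalSpace M] [ChartedSpace (EuclideanSpace ℝ (Fin n)) M]
  [IsManifold (𝓡 n) ∞ M] [Bundle.RiemannianBundle (fun x : M ↦ TangentSpace (𝓡 n) x)]
  [IsContMDiffRiemannianBundle (𝓡 n) ∞ (EuclideanSpace ℝ (Fin n))
    (fun x : M ↦ TangentSpace (𝓡 n) x)]

/-- A smooth chart `φ` of `M` to `ℝⁿ` on whose domain `g = e^{2u} φ^* ḡ` for a smooth function `u`,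
where `ḡ` is the Euclidean metric. Values of `u` outside the domain of `φ` are irrelevant. -/
structure ConformalChart where
  chart : OpenPartialHomeomorph M (EuclideanSpace ℝ (Fin n))
  mem_maximalAtlas : chart ∈ IsManifold.maximalAtlas (𝓡 n) ∞ M
  factor : M → ℝ
  contMDiffOn_factor : ContMDiffOn (𝓡 n) 𝓘(ℝ, ℝ) ∞ factor chart.source
  conformal : ∀ x ∈ chart.source, ∀ v w : TangentSpace (𝓡 n) x,
    inner ℝ v w = Real.exp (2 * factor x) *
      inner ℝ (mfderiv (𝓡 n) (𝓡 n) chart x v) (mfderiv (𝓡 n) (𝓡 n) chart x w)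

/-- The metric is locally conformally flat: each point lies in the domain of a conformal chart. -/
def IsLocallyConformallyFlat : Prop :=
  ∀ x : M, ∃ c : ConformalChart n M, x ∈ c.chart.source

variable {n M}

/-- `OS(g, φ^* ḡ)` on the domain of a conformal chart `φ`: since `φ` is an isometry from `φ^* ḡ` to
the Euclidean metric `ḡ`, it is the pullback by `φ` of `OS(e^{2 u ∘ φ⁻¹} ḡ, ḡ)`. -/
noncomputable def ConformalChart.osgoodStowe (c : ConformalChart n M) (x : M)
    (v w : TangentSpace (𝓡 n) x) : ℝ :=
  ConformallyFlat.osgoodStowe (𝓡 n) (c.factor ∘ c.chart.symm) (c.chart x)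
    (mfderiv (𝓡 n) (𝓡 n) c.chart x v) (mfderiv (𝓡 n) (𝓡 n) c.chart x w)

open scoped Classical in
/-- The tensor `OS(g)` of a conformally flat structure given by a set `A` of conformal charts:
at each point, `OS(g, φ^* ḡ)` for any chart `φ ∈ A` around that point. -/
noncomputable def osgoodStoweOf (A : Set (ConformalChart n M)) (x : M)
    (v w : TangentSpace (𝓡 n) x) : ℝ :=
  if h : ∃ c ∈ A, x ∈ c.chart.source then h.choose.osgoodStowe x v w else 0

/-- `g B = 2 OS(g) - S(g) / (n (n - 1)) g`, where `OS(g)` is formed with the charts in `A`. -/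
def IsShapeOperatorAtInfinity (A : Set (ConformalChart n M))
    (B : Π x : M, TangentSpace (𝓡 n) x →L[ℝ] TangentSpace (𝓡 n) x) : Prop :=
  ∀ (x : M) (v w : TangentSpace (𝓡 n) x),
    inner ℝ (B x v) w = 2 * osgoodStoweOf A x v w
      - scalarCurvature (𝓡 n) x / ((n : ℝ) * ((n : ℝ) - 1)) * inner ℝ v w

/-- The identification of `ℝ²` with `ℂ`. -/
noncomputable def toComplex (hn : n = 2) (p : EuclideanSpace ℝ (Fin n)) : ℂ :=
  ⟨p ⟨0, by omega⟩, p ⟨1, by omega⟩⟩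

/-- In dimension two: a complex projective structure compatible with the metric, that is, an atlas
of conformal charts to `ℝ² = ℂ` whose transition maps are locally restrictions of Möbius
transformations `z ↦ (a z + b) / (c z + d)`. (The denominator cannot vanish at the points of
`ℂ` where the equation in `transition` holds.) -/
structure IsComplexProjectiveAtlas (hn : n = 2) (A : Set (ConformalChart n M)) : Prop where
  cover : ∀ x : M, ∃ φ ∈ A, x ∈ φ.chart.source
  transition : ∀ φ ∈ A, ∀ ψ ∈ A, ∀ x ∈ φ.chart.source ∩ ψ.chart.source,
    ∃ a b c d : ℂ, a * d - b * c ≠ 0 ∧ ∀ᶠ y in 𝓝 x,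
      toComplex hn (ψ.chart y) * (c * toComplex hn (φ.chart y) + d) =
        a * toComplex hn (φ.chart y) + b

end ConformallyFlat

end ConformallyFlat

set_option linter.unusedSectionVars false

namespace ConformallyFlat

/-- Differentiability at a point of a vector field on a manifold. -/
abbrev MDiffFieldAt {E : Type*} [NormedAddCommGroup E] [NormedSpace ℝ E]
    {H : Type*} [TopologicalSpace H] (I : ModelWithCorners ℝ E H)
    {M : Type*} [TopologicalSpace M] [ChartedSpace H M] [IsManifold I ∞ M]
    (X : Π x : M, TangentSpace I x) (x : M) : Prop :=
  MDiffAt (T% X) x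

theorem mdiffFieldAt_vectorSpace {E : Type*} [NormedAddCommGroup E] [NormedSpace ℝ E]
    {G : E → E} {p : E} (hG : DifferentiableAt ℝ G p) : MDiffFieldAt 𝓘(ℝ, E) G p := by
  refine (mdifferentiableAt_section _ _).2 ?_
  simpa [TangentSpace] using! hG.mdifferentiableAt

theorem mlieBracket_vectorSpace {E : Type*} [NormedAddCommGroup E] [NormedSpace ℝ E]
    (V W : Π p : E, TangentSpace 𝓘(ℝ, E) p) :
    VectorField.mlieBracket 𝓘(ℝ, E) V W = VectorField.lieBracket ℝ V W := by
  rw [← VectorField.mlieBracketWithin_univ, VectorField.mlieBracketWithin_eq_lieBracketWithin]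
  exact VectorField.lieBracketWithin_univ

section Charts

open VectorField

variable {n : ℕ} {M : Type*} [TopologicalSpace M] [ChartedSpace (EuclideanSpace ℝ (Fin n)) M]
  [IsManifold (𝓡 n) ∞ M] [Bundle.RiemannianBundle (fun x : M ↦ TangentSpace (𝓡 n) x)]
  [IsContMDiffRiemannianBundle (𝓡 n) ∞ (EuclideanSpace ℝ (Fin n))
    (fun x : M ↦ TangentSpace (𝓡 n) x)]

namespace ConformalChart

variable (c : ConformalChart n M)

/-- The conformal factor of a chart, as a function on the image of the chart. -/
noncomputable def expr (c : ConformalChart n M) : EuclideanSpace ℝ (Fin n) → ℝ :=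
  c.factor ∘ c.chart.symm

/-- The vector field on the manifold with coordinate expression `G`. -/
noncomputable def field (c : ConformalChart n M)
    (G : EuclideanSpace ℝ (Fin n) → EuclideanSpace ℝ (Fin n)) :
    Π x : M, TangentSpace (𝓡 n) x :=
  mpullback (𝓡 n) (𝓡 n) c.chart G

theorem contMDiffAt_chart {x : M} (hx : x ∈ c.chart.source) :
    ContMDiffAt (𝓡 n) (𝓡 n) ∞ c.chart x :=
  contMDiffAt_of_mem_maximalAtlas c.mem_maximalAtlas hx

theorem contMDiffAt_chart_symm {p : EuclideanSpace ℝ (Fin n)} (hp : p ∈ c.chart.target) :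
    ContMDiffAt (𝓡 n) (𝓡 n) ∞ c.chart.symm p :=
  contMDiffAt_symm_of_mem_maximalAtlas c.mem_maximalAtlas hp

theorem mdifferentiable_chart : c.chart.MDifferentiable (𝓡 n) (𝓡 n) :=
  ⟨fun _ hx ↦ ((c.contMDiffAt_chart hx).mdifferentiableAt (by simp)).mdifferentiableWithinAt,
    fun _ hp ↦ ((c.contMDiffAt_chart_symm hp).mdifferentiableAt (by simp)).mdifferentiableWithinAt⟩

theorem isInvertible_mfderiv {x : M} (hx : x ∈ c.chart.source) :
    (mfderiv (𝓡 n) (𝓡 n) c.chart x).IsInvertible :=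
  ⟨c.mdifferentiable_chart.mfderiv hx, rfl⟩

theorem mfderiv_field {x : M} (hx : x ∈ c.chart.source)
    (G : EuclideanSpace ℝ (Fin n) → EuclideanSpace ℝ (Fin n)) :
    mfderiv (𝓡 n) (𝓡 n) c.chart x (c.field G x) = G (c.chart x) := by
  have := c.isInvertible_mfderiv hx
  exact this.self_apply_inverse _

theorem mfderiv_chart_injective {x : M} (hx : x ∈ c.chart.source) {v w : TangentSpace (𝓡 n) x}
    (h : mfderiv (𝓡 n) (𝓡 n) c.chart x v = mfderiv (𝓡 n) (𝓡 n) c.chart x w) : v = w :=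
  (c.isInvertible_mfderiv hx).injective h

theorem field_mfderiv {x : M} (hx : x ∈ c.chart.source) (v : TangentSpace (𝓡 n) x) :
    c.field (fun _ ↦ mfderiv (𝓡 n) (𝓡 n) c.chart x v) x = v :=
  c.mfderiv_chart_injective hx (c.mfderiv_field hx _)

theorem inner_field {x : M} (hx : x ∈ c.chart.source)
    (F G : EuclideanSpace ℝ (Fin n) → EuclideanSpace ℝ (Fin n)) :
    inner ℝ (c.field F x) (c.field G x) =
      Real.exp (2 * c.expr (c.chart x)) * inner ℝ (F (c.chart x)) (G (c.chart x)) := by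
  rw [c.conformal x hx, c.mfderiv_field hx, c.mfderiv_field hx, expr, Function.comp_apply,
    c.chart.left_inv hx]
  rfl

theorem eventually_mem_source {x : M} (hx : x ∈ c.chart.source) : ∀ᶠ y in 𝓝 x, y ∈ c.chart.source :=
  c.chart.open_source.mem_nhds hx

theorem contDiffAt_expr {x : M} (hx : x ∈ c.chart.source) : ContDiffAt ℝ ∞ c.expr (c.chart x) := by
  rw [← contMDiffAt_iff_contDiffAt]
  have h1 := c.contMDiffAt_chart_symm (c.chart.map_source hx)
  have h2 : ContMDiffAt (𝓡 n) 𝓘(ℝ, ℝ) ∞ c.factor (c.chart.symm (c.chart x)) := by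
    rw [c.chart.left_inv hx]
    exact c.contMDiffOn_factor.contMDiffAt (c.eventually_mem_source hx)
  exact h2.comp _ h1

theorem mdifferentiableAt_field {x : M} (hx : x ∈ c.chart.source)
    {G : EuclideanSpace ℝ (Fin n) → EuclideanSpace ℝ (Fin n)}
    (hG : DifferentiableAt ℝ G (c.chart x)) : MDiffFieldAt (𝓡 n) (c.field G) x :=
  MDifferentiableAt.mpullback_vectorField (n := ∞) (mdiffFieldAt_vectorSpace hG)
    (c.contMDiffAt_chart hx) (c.isInvertible_mfderiv hx) (by norm_cast)

theorem mvfderiv_comp_chart {x : M} (hx : x ∈ c.chart.source) {f : M → ℝ}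
    {g : EuclideanSpace ℝ (Fin n) → ℝ} (hfg : ∀ᶠ y in 𝓝 x, f y = g (c.chart y))
    (hg : DifferentiableAt ℝ g (c.chart x)) (v : TangentSpace (𝓡 n) x) :
    mvfderiv (𝓡 n) f x v = fderiv ℝ g (c.chart x) (mfderiv (𝓡 n) (𝓡 n) c.chart x v) := by
  have h1 : mvfderiv (𝓡 n) f x = mvfderiv (𝓡 n) (g ∘ c.chart) x := by
    ext w
    exact congrArg (fun L : TangentSpace (𝓡 n) x →L[ℝ] ℝ ↦ L w)
      (Filter.EventuallyEq.mfderiv_eq (f := g ∘ c.chart) (f₁ := f) hfg)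
  rw [h1, mvfderiv_comp_apply x hg.mdifferentiableAt
    ((c.contMDiffAt_chart hx).mdifferentiableAt (by simp))]
  rw [mvfderiv, mfderiv_eq_fderiv]
  rfl

theorem mlieBracket_field {x : M} (hx : x ∈ c.chart.source)
    {F G : EuclideanSpace ℝ (Fin n) → EuclideanSpace ℝ (Fin n)}
    (hF : DifferentiableAt ℝ F (c.chart x)) (hG : DifferentiableAt ℝ G (c.chart x)) :
    mlieBracket (𝓡 n) (c.field F) (c.field G) x =
      c.field (fun p ↦ fderiv ℝ G p (F p) - fderiv ℝ F p (G p)) x := by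
  have : IsManifold (𝓡 n) (minSmoothness ℝ 2) M := by
    rw [minSmoothness_of_isRCLikeNormedField]; infer_instance
  have : IsManifold (𝓡 n) (minSmoothness ℝ 2) (EuclideanSpace ℝ (Fin n)) := by
    rw [minSmoothness_of_isRCLikeNormedField]; infer_instance
  have h := mpullback_mlieBracket (n := ∞) (mdiffFieldAt_vectorSpace hF)
    (mdiffFieldAt_vectorSpace hG) (c.contMDiffAt_chart hx)
    (by rw [minSmoothness_of_isRCLikeNormedField]; norm_cast)
  exact h.symm.trans (congrArg (fun Z : Π p : EuclideanSpace ℝ (Fin n), TangentSpace (𝓡 n) p ↦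
    mpullback (𝓡 n) (𝓡 n) c.chart Z x) (mlieBracket_vectorSpace F G))

theorem mvfderiv_inner_field {x : M} (hx : x ∈ c.chart.source)
    {G K : EuclideanSpace ℝ (Fin n) → EuclideanSpace ℝ (Fin n)}
    (hG : DifferentiableAt ℝ G (c.chart x)) (hK : DifferentiableAt ℝ K (c.chart x))
    (F : EuclideanSpace ℝ (Fin n) → EuclideanSpace ℝ (Fin n)) :
    mvfderiv (𝓡 n) (fun y ↦ inner ℝ (c.field G y) (c.field K y)) x (c.field F x) =
      Real.exp (2 * c.expr (c.chart x)) *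
        (2 * fderiv ℝ c.expr (c.chart x) (F (c.chart x)) * inner ℝ (G (c.chart x)) (K (c.chart x))
          + inner ℝ (fderiv ℝ G (c.chart x) (F (c.chart x))) (K (c.chart x))
          + inner ℝ (G (c.chart x)) (fderiv ℝ K (c.chart x) (F (c.chart x)))) := by
  have hU := (c.contDiffAt_expr hx).differentiableAt (by simp)
  have h1 := ((hU.hasFDerivAt.const_mul 2).exp).mul (hG.hasFDerivAt.inner ℝ hK.hasFDerivAt)
  rw [c.mvfderiv_comp_chart hx (g := fun p ↦ Real.exp (2 * c.expr p) * inner ℝ (G p) (K p))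
    ((c.eventually_mem_source hx).mono fun y hy ↦ c.inner_field hy G K) h1.differentiableAt,
    c.mfderiv_field hx,
    show fderiv ℝ (fun p ↦ Real.exp (2 * c.expr p) * inner ℝ (G p) (K p)) (c.chart x) = _ from
      h1.fderiv]
  simp
  ring

theorem ext_inner_field {x : M} (hx : x ∈ c.chart.source) {v w : TangentSpace (𝓡 n) x}
    (h : ∀ b : EuclideanSpace ℝ (Fin n), inner ℝ v (c.field (fun _ ↦ b) x) =
      inner ℝ w (c.field (fun _ ↦ b) x)) : v = w := by
  refine ext_inner_right ℝ fun z ↦ ?_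
  rw [← c.field_mfderiv hx z]
  exact h _

theorem field_congr {x : M} {F G : EuclideanSpace ℝ (Fin n) → EuclideanSpace ℝ (Fin n)}
    (h : F (c.chart x) = G (c.chart x)) : c.field F x = c.field G x :=
  congrArg (mfderiv (𝓡 n) (𝓡 n) c.chart x).inverse h

end ConformalChart

/-- The coordinate expression of `∇_F G` for the metric `e^{2 U} ḡ`. -/
noncomputable def conn (U : EuclideanSpace ℝ (Fin n) → ℝ)
    (F G : EuclideanSpace ℝ (Fin n) → EuclideanSpace ℝ (Fin n)) (p : EuclideanSpace ℝ (Fin n)) :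
    EuclideanSpace ℝ (Fin n) :=
  fderiv ℝ G p (F p) + fderiv ℝ U p (F p) • G p + fderiv ℝ U p (G p) • F p
    - inner ℝ (F p) (G p) • gradient U p

theorem inner_gradient (U : EuclideanSpace ℝ (Fin n) → ℝ) (p v : EuclideanSpace ℝ (Fin n)) :
    inner ℝ (gradient U p) v = fderiv ℝ U p v := by
  simp [gradient]

namespace ConformalChart

variable (c : ConformalChart n M)

theorem leviCivita_field {x : M} (hx : x ∈ c.chart.source)
    {G : EuclideanSpace ℝ (Fin n) → EuclideanSpace ℝ (Fin n)}
    (hG : DifferentiableAt ℝ G (c.chart x))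
    (F : EuclideanSpace ℝ (Fin n) → EuclideanSpace ℝ (Fin n)) :
    leviCivita (𝓡 n) (c.field G) x (c.field F x) = c.field (conn c.expr F G) x := by
  refine c.ext_inner_field hx fun b ↦ ?_
  have hF : c.field F x = c.field (fun _ ↦ F (c.chart x)) x := c.field_congr rfl
  have ha : DifferentiableAt ℝ (fun _ : EuclideanSpace ℝ (Fin n) ↦ F (c.chart x)) (c.chart x) :=
    differentiableAt_const _
  have hb : DifferentiableAt ℝ (fun _ : EuclideanSpace ℝ (Fin n) ↦ b) (c.chart x) :=
    differentiableAt_const _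
  rw [hF]
  refine (inner_koszulCov (𝓡 n) (c.mdifferentiableAt_field hx ha)
    (c.mdifferentiableAt_field hx hG) (c.mdifferentiableAt_field hx hb)).trans ?_
  rw [koszul, c.mvfderiv_inner_field hx hG hb, c.mvfderiv_inner_field hx ha hb,
    c.mvfderiv_inner_field hx ha hG, c.mlieBracket_field hx ha hG, c.mlieBracket_field hx ha hb,
    c.mlieBracket_field hx hG hb, c.inner_field hx, c.inner_field hx, c.inner_field hx,
    c.inner_field hx]
  simp [conn, inner_add_left, inner_sub_left, inner_smul_left]
  rw [real_inner_comm (F (c.chart x)) (fderiv ℝ G (c.chart x) b)]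
  ring

theorem exists_field_eq {x : M} (hx : x ∈ c.chart.source) {X : Π x : M, TangentSpace (𝓡 n) x}
    (hX : ContMDiffAt (𝓡 n) (𝓡 n).tangent ∞ (fun y ↦ (⟨y, X y⟩ : TangentBundle (𝓡 n) M)) x) :
    ∃ A : EuclideanSpace ℝ (Fin n) → EuclideanSpace ℝ (Fin n), ContDiffAt ℝ ∞ A (c.chart x) ∧
      ∀ y ∈ c.chart.source, X y = c.field A y := by
  have hd := c.mdifferentiable_chart
  have hp := c.chart.map_source hx
  let A : EuclideanSpace ℝ (Fin n) → EuclideanSpace ℝ (Fin n) :=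
    fun p ↦ mfderiv (𝓡 n) (𝓡 n) c.chart (c.chart.symm p) (X (c.chart.symm p))
  refine ⟨A, ?_, fun y hy ↦ ?_⟩
  · have hinv : ∀ p ∈ c.chart.target, (mfderiv (𝓡 n) (𝓡 n) c.chart.symm p).IsInvertible :=
      fun p hp ↦ ⟨hd.symm.mfderiv hp, rfl⟩
    have hX' : ContMDiffAt (𝓡 n) (𝓡 n).tangent ∞ (fun y ↦ (⟨y, X y⟩ : TangentBundle (𝓡 n) M))
        (c.chart.symm (c.chart x)) := by rwa [c.chart.left_inv hx]
    have h1 := ContMDiffAt.mpullback_vectorField_preimage (m := ∞) hX'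
      (c.contMDiffAt_chart_symm hp) (hinv _ hp) (by simp)
    rw [contMDiffAt_vectorSpace_iff_contDiffAt] at h1
    refine h1.congr_of_eventuallyEq ?_
    filter_upwards [c.chart.open_target.mem_nhds hp] with p hp
    refine (hinv p hp).injective ?_
    refine Eq.trans ?_ ((hinv p hp).self_apply_inverse _).symm
    have h2 := hd.symm_comp_deriv (c.chart.map_target hp)
    rw [c.chart.right_inv hp] at h2
    exact congrArg (fun L ↦ L (X (c.chart.symm p))) h2
  · refine c.mfderiv_chart_injective hy ?_
    rw [c.mfderiv_field hy]
    have : ∀ z, z = y → (mfderiv (𝓡 n) (𝓡 n) c.chart y (X y) : EuclideanSpace ℝ (Fin n)) =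
      mfderiv (𝓡 n) (𝓡 n) c.chart z (X z) := by rintro z rfl; rfl
    exact this _ (c.chart.left_inv hy)

end ConformalChart

theorem contDiffAt_gradient {U : EuclideanSpace ℝ (Fin n) → ℝ} {p : EuclideanSpace ℝ (Fin n)}
    (hU : ContDiffAt ℝ ∞ U p) : ContDiffAt ℝ ∞ (gradient U) p :=
  ((InnerProductSpace.toDual ℝ
    (EuclideanSpace ℝ (Fin n))).symm.toContinuousLinearEquiv.contDiff.contDiffAt).comp p
      (hU.fderiv_right (m := ∞) (by simp))

theorem inner_fderiv_gradient {U : EuclideanSpace ℝ (Fin n) → ℝ} {p : EuclideanSpace ℝ (Fin n)}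
    (hU : ContDiffAt ℝ ∞ U p) (v w : EuclideanSpace ℝ (Fin n)) :
    inner ℝ (fderiv ℝ (gradient U) p v) w = fderiv ℝ (fderiv ℝ U) p v w := by
  have h1 := ((contDiffAt_gradient hU).differentiableAt (by simp)).hasFDerivAt.inner ℝ
    (hasFDerivAt_const w p)
  have h2 := ((hU.fderiv_right (m := ∞) (by simp)).differentiableAt (by simp)).hasFDerivAt.clm_apply
    (hasFDerivAt_const w p)
  have h3 : (fun q ↦ inner ℝ (gradient U q) w) = fun q ↦ fderiv ℝ U q w :=
    funext fun q ↦ inner_gradient U q w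
  rw [h3] at h1
  simpa using congrArg (fun L ↦ L v) (h1.unique h2)

section Calculus

variable {U : EuclideanSpace ℝ (Fin n) → ℝ}
  {F G K : EuclideanSpace ℝ (Fin n) → EuclideanSpace ℝ (Fin n)} {p : EuclideanSpace ℝ (Fin n)}

theorem contDiffAt_conn (hU : ContDiffAt ℝ ∞ U p) (hF : ContDiffAt ℝ ∞ F p)
    (hG : ContDiffAt ℝ ∞ G p) : ContDiffAt ℝ ∞ (conn U F G) p := by
  have h1 := hU.fderiv_right (m := ∞) (by simp)
  have h2 := hG.fderiv_right (m := ∞) (by simp)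
  have h3 := contDiffAt_gradient hU
  exact (((h2.clm_apply hF).add ((h1.clm_apply hF).smul hG)).add ((h1.clm_apply hG).smul hF)).sub
    ((hF.inner ℝ hG).smul h3)

theorem inner_fderiv_conn (hU : ContDiffAt ℝ ∞ U p) (hF : ContDiffAt ℝ ∞ F p)
    (hG : ContDiffAt ℝ ∞ G p) (v d : EuclideanSpace ℝ (Fin n)) :
    inner ℝ (fderiv ℝ (conn U F G) p v) d =
      inner ℝ (fderiv ℝ (fderiv ℝ G) p v (F p)) d + inner ℝ (fderiv ℝ G p (fderiv ℝ F p v)) d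
      + (fderiv ℝ (fderiv ℝ U) p v (F p) + fderiv ℝ U p (fderiv ℝ F p v)) * inner ℝ (G p) d
      + fderiv ℝ U p (F p) * inner ℝ (fderiv ℝ G p v) d
      + (fderiv ℝ (fderiv ℝ U) p v (G p) + fderiv ℝ U p (fderiv ℝ G p v)) * inner ℝ (F p) d
      + fderiv ℝ U p (G p) * inner ℝ (fderiv ℝ F p v) d
      - (inner ℝ (fderiv ℝ F p v) (G p) + inner ℝ (F p) (fderiv ℝ G p v)) * fderiv ℝ U p d
      - inner ℝ (F p) (G p) * fderiv ℝ (fderiv ℝ U) p v d := by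
  have d1 := ((hU.fderiv_right (m := ∞) (by simp)).differentiableAt (by simp)).hasFDerivAt
  have d2 := ((hG.fderiv_right (m := ∞) (by simp)).differentiableAt (by simp)).hasFDerivAt
  have d3 := ((contDiffAt_gradient hU).differentiableAt (by simp)).hasFDerivAt
  have dF := (hF.differentiableAt (by simp)).hasFDerivAt
  have dG := (hG.differentiableAt (by simp)).hasFDerivAt
  have h := (((d2.clm_apply dF).add ((d1.clm_apply dF).smul dG)).add
    ((d1.clm_apply dG).smul dF)).sub ((dF.inner ℝ dG).smul d3)
  rw [show fderiv ℝ (conn U F G) p = _ from h.fderiv]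
  simp [inner_add_left, inner_sub_left, inner_smul_left, inner_fderiv_gradient hU]
  ring

/-- The coordinate expression of the curvature `R(F, G) K` of the metric `e^{2 U} ḡ`. -/
noncomputable def curv (U : EuclideanSpace ℝ (Fin n) → ℝ)
    (F G K : EuclideanSpace ℝ (Fin n) → EuclideanSpace ℝ (Fin n)) (p : EuclideanSpace ℝ (Fin n)) :
    EuclideanSpace ℝ (Fin n) :=
  conn U F (conn U G K) p - conn U G (conn U F K) p
    - conn U (fun q ↦ fderiv ℝ G q (F q) - fderiv ℝ F q (G q)) K p

/-- The tensor `Hess U - dU ⊗ dU + |dU|² ḡ / 2` on Euclidean space: minus the Schouten tensor of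
`e^{2 U} ḡ`. -/
noncomputable def schouten (U : EuclideanSpace ℝ (Fin n) → ℝ)
    (p v w : EuclideanSpace ℝ (Fin n)) : ℝ :=
  fderiv ℝ (fderiv ℝ U) p v w - fderiv ℝ U p v * fderiv ℝ U p w
    + 2⁻¹ * fderiv ℝ U p (gradient U p) * inner ℝ v w

theorem fderiv_fderiv_comm {E F : Type*} [NormedAddCommGroup E] [NormedSpace ℝ E]
    [NormedAddCommGroup F] [NormedSpace ℝ F] {f : E → F} {p : E} (hf : ContDiffAt ℝ ∞ f p)
    (v w : E) : fderiv ℝ (fderiv ℝ f) p v w = fderiv ℝ (fderiv ℝ f) p w v :=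
  (hf.isSymmSndFDerivAt (by rw [minSmoothness_of_isRCLikeNormedField]; norm_cast)).eq v w

theorem inner_curv (hU : ContDiffAt ℝ ∞ U p) (hF : ContDiffAt ℝ ∞ F p)
    (hG : ContDiffAt ℝ ∞ G p) (hK : ContDiffAt ℝ ∞ K p) (d : EuclideanSpace ℝ (Fin n)) :
    inner ℝ (curv U F G K p) d =
      schouten U p (F p) (K p) * inner ℝ (G p) d + inner ℝ (F p) (K p) * schouten U p (G p) d
      - schouten U p (G p) (K p) * inner ℝ (F p) d
      - inner ℝ (G p) (K p) * schouten U p (F p) d := by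
  have s1 := fderiv_fderiv_comm hU (F p) (G p)
  have s2 := fderiv_fderiv_comm hK (F p) (G p)
  rw [curv, inner_sub_left, inner_sub_left, conn, conn, conn]
  simp only [inner_add_left, inner_sub_left, inner_smul_left, inner_gradient,
    inner_fderiv_conn hU hG hK, inner_fderiv_conn hU hF hK]
  simp only [schouten, conn, map_add, map_sub, map_smul, inner_add_left, inner_sub_left,
    inner_add_right, inner_sub_right, inner_smul_left, inner_smul_right, inner_gradient, s1, s2,
    smul_eq_mul, conj_trivial]
  rw [real_inner_comm (gradient U p) (F p), real_inner_comm (gradient U p) (G p),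
    real_inner_comm (G p) (F p)]
  simp only [inner_gradient]
  ring

end Calculus

namespace ConformalChart

variable (c : ConformalChart n M)

theorem mdiffFieldAt_congr {x : M} {X Y : Π x : M, TangentSpace (𝓡 n) x}
    (hX : MDiffFieldAt (𝓡 n) X x) (h : ∀ᶠ y in 𝓝 x, Y y = X y) : MDiffFieldAt (𝓡 n) Y x :=
  MDifferentiableAt.congr_of_eventuallyEq hX (h.mono fun y hy ↦ by
    change (⟨y, Y y⟩ : TangentBundle (𝓡 n) M) = ⟨y, X y⟩
    rw [hy])

theorem leviCivita_eq_field {x : M} (hx : x ∈ c.chart.source)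
    {Y : Π x : M, TangentSpace (𝓡 n) x}
    {G : EuclideanSpace ℝ (Fin n) → EuclideanSpace ℝ (Fin n)}
    (hG : DifferentiableAt ℝ G (c.chart x)) (hY : ∀ᶠ y in 𝓝 x, Y y = c.field G y)
    (F : EuclideanSpace ℝ (Fin n) → EuclideanSpace ℝ (Fin n)) :
    leviCivita (𝓡 n) Y x (c.field F x) = c.field (conn c.expr F G) x := by
  have hG' := c.mdifferentiableAt_field hx hG
  rw [(koszulCov_isCov (𝓡 n) (M := M)).congr_of_eventuallyEq
    (mdiffFieldAt_congr hG' hY) hG' Filter.univ_mem hY |> fun h ↦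
      (h : leviCivita (𝓡 n) Y x = leviCivita (𝓡 n) (c.field G) x)]
  exact c.leviCivita_field hx hG F

theorem eventually_differentiableAt {x : M} (hx : x ∈ c.chart.source)
    {G : EuclideanSpace ℝ (Fin n) → EuclideanSpace ℝ (Fin n)}
    (hG : ContDiffAt ℝ ∞ G (c.chart x)) :
    ∀ᶠ y in 𝓝 x, DifferentiableAt ℝ G (c.chart y) :=
  (c.chart.continuousAt hx).eventually
    (((hG.of_le (m := 1) (by simp)).eventually (by simp)).mono fun _ h ↦
      h.differentiableAt (by simp))

theorem curvature_eq_field {x : M} (hx : x ∈ c.chart.source)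
    {X Y Z : Π x : M, TangentSpace (𝓡 n) x}
    {F G K : EuclideanSpace ℝ (Fin n) → EuclideanSpace ℝ (Fin n)}
    (hF : ContDiffAt ℝ ∞ F (c.chart x)) (hG : ContDiffAt ℝ ∞ G (c.chart x))
    (hK : ContDiffAt ℝ ∞ K (c.chart x)) (hX : ∀ᶠ y in 𝓝 x, X y = c.field F y)
    (hY : ∀ᶠ y in 𝓝 x, Y y = c.field G y) (hZ : ∀ᶠ y in 𝓝 x, Z y = c.field K y) :
    curvature (𝓡 n) X Y Z x = c.field (curv c.expr F G K) x := by
  have hU := c.contDiffAt_expr hx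
  have h1 : ∀ {W : Π x : M, TangentSpace (𝓡 n) x}
      {A : EuclideanSpace ℝ (Fin n) → EuclideanSpace ℝ (Fin n)},
      (∀ᶠ y in 𝓝 x, W y = c.field A y) →
      ∀ᶠ y in 𝓝 x, leviCivita (𝓡 n) Z y (W y) = c.field (conn c.expr A K) y := by
    intro W A hW
    filter_upwards [hW, hZ.eventually_nhds, c.eventually_mem_source hx,
      c.eventually_differentiableAt hx hK] with y h1 h2 h3 h4
    rw [h1]
    exact c.leviCivita_eq_field h3 h4 h2 A
  have h2 : mlieBracket (𝓡 n) X Y x = _ :=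
    (Filter.EventuallyEq.mlieBracket_vectorField_eq hX hY).trans
      (c.mlieBracket_field hx (hF.differentiableAt (by simp)) (hG.differentiableAt (by simp)))
  rw [curvature, h2, hX.self_of_nhds, hY.self_of_nhds,
    c.leviCivita_eq_field hx ((contDiffAt_conn hU hG hK).differentiableAt (by simp)) (h1 hY),
    c.leviCivita_eq_field hx ((contDiffAt_conn hU hF hK).differentiableAt (by simp)) (h1 hX),
    c.leviCivita_eq_field hx (hK.differentiableAt (by simp)) hZ]
  refine c.mfderiv_chart_injective hx ?_
  rw [map_sub, map_sub]
  simp only [c.mfderiv_field hx]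
  rfl

/-- The tensor `Hess u - du ⊗ du + |du|² φ^*ḡ / 2` of a conformal chart `φ`. -/
noncomputable def schoutenAt (x : M) (v w : TangentSpace (𝓡 n) x) : ℝ :=
  schouten c.expr (c.chart x) (mfderiv (𝓡 n) (𝓡 n) c.chart x v) (mfderiv (𝓡 n) (𝓡 n) c.chart x w)

theorem riemann_eq {x : M} (hx : x ∈ c.chart.source) (v₁ v₂ v₃ v₄ : TangentSpace (𝓡 n) x) :
    riemann (𝓡 n) x v₁ v₂ v₃ v₄ =
      c.schoutenAt x v₁ v₃ * inner ℝ v₂ v₄ + inner ℝ v₁ v₃ * c.schoutenAt x v₂ v₄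
      - c.schoutenAt x v₂ v₃ * inner ℝ v₁ v₄ - inner ℝ v₂ v₃ * c.schoutenAt x v₁ v₄ := by
  have key : ∀ v : TangentSpace (𝓡 n) x,
      ∃ A : EuclideanSpace ℝ (Fin n) → EuclideanSpace ℝ (Fin n), ContDiffAt ℝ ∞ A (c.chart x) ∧
        (∀ᶠ y in 𝓝 x, FiberBundle.extend (EuclideanSpace ℝ (Fin n)) v y = c.field A y) ∧
        A (c.chart x) = mfderiv (𝓡 n) (𝓡 n) c.chart x v := by
    intro v
    obtain ⟨A, hA, h⟩ := c.exists_field_eq hx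
      (FiberBundle.contMDiffAt_extend (𝓡 n) (EuclideanSpace ℝ (Fin n)) v)
    refine ⟨A, hA, (c.eventually_mem_source hx).mono h, ?_⟩
    rw [← c.mfderiv_field hx A, ← h x hx, FiberBundle.extend_apply_self]
  obtain ⟨A₁, h₁, e₁, a₁⟩ := key v₁
  obtain ⟨A₂, h₂, e₂, a₂⟩ := key v₂
  obtain ⟨A₃, h₃, e₃, a₃⟩ := key v₃
  rw [riemann, c.curvature_eq_field hx h₁ h₂ h₃ e₁ e₂ e₃]
  have hd : ∀ v w : TangentSpace (𝓡 n) x, inner ℝ v w = _ := c.conformal x hx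
  rw [hd _ v₄, c.mfderiv_field hx, hd v₂ v₄, hd v₁ v₃, hd v₁ v₄, hd v₂ v₃]
  refine (congrArg _ (inner_curv (c.contDiffAt_expr hx) h₁ h₂ h₃ _)).trans ?_
  rw [a₁, a₂, a₃]
  simp only [schoutenAt]
  change _ * (_ * inner ℝ (mfderiv (𝓡 n) (𝓡 n) c.chart x v₂) (mfderiv (𝓡 n) (𝓡 n) c.chart x v₄) +
    inner ℝ (mfderiv (𝓡 n) (𝓡 n) c.chart x v₁) (mfderiv (𝓡 n) (𝓡 n) c.chart x v₃) * _ -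
    _ * inner ℝ (mfderiv (𝓡 n) (𝓡 n) c.chart x v₁) (mfderiv (𝓡 n) (𝓡 n) c.chart x v₄) -
    inner ℝ (mfderiv (𝓡 n) (𝓡 n) c.chart x v₂) (mfderiv (𝓡 n) (𝓡 n) c.chart x v₃) * _) = _
  ring

end ConformalChart

/-- Bilinearity and symmetry of a function of two vectors. -/
structure IsSymmBilin {V : Type*} [AddCommGroup V] [Module ℝ V] (T : V → V → ℝ) : Prop where
  add_left : ∀ u v w, T (u + v) w = T u w + T v w
  smul_left : ∀ (r : ℝ) v w, T (r • v) w = r * T v w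
  symm : ∀ v w, T v w = T w v

namespace IsSymmBilin

variable {V : Type*} [AddCommGroup V] [Module ℝ V] {T : V → V → ℝ}

/-- The linear form `T · w`. -/
def toLinearMap (hT : IsSymmBilin T) (w : V) : V →ₗ[ℝ] ℝ where
  toFun v := T v w
  map_add' u v := hT.add_left u v w
  map_smul' r v := hT.smul_left r v w

theorem comp {W : Type*} [AddCommGroup W] [Module ℝ W] (hT : IsSymmBilin T) (L : W →ₗ[ℝ] V) :
    IsSymmBilin (fun v w ↦ T (L v) (L w)) where
  add_left u v w := by simp [hT.add_left]
  smul_left r v w := by simp [hT.smul_left]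
  symm v w := hT.symm _ _

theorem sum_repr {ι : Type*} [Fintype ι] {V : Type*} [NormedAddCommGroup V]
    [InnerProductSpace ℝ V] {T : V → V → ℝ} (hT : IsSymmBilin T) (b : OrthonormalBasis ι ℝ V)
    (v w : V) : ∑ i, inner ℝ (b i) v * T (b i) w = T v w := by
  have := congrArg (hT.toLinearMap w) (b.sum_repr' v)
  rw [map_sum] at this
  simpa [map_smul] using! this

end IsSymmBilin

theorem isSymmBilin_schouten {U : EuclideanSpace ℝ (Fin n) → ℝ} {p : EuclideanSpace ℝ (Fin n)}
    (hU : ContDiffAt ℝ ∞ U p) : IsSymmBilin (schouten U p) where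
  add_left u v w := by simp [schouten, inner_add_left]; ring
  smul_left r v w := by simp [schouten, inner_smul_left]; ring
  symm v w := by
    rw [schouten, schouten, fderiv_fderiv_comm hU v w, real_inner_comm]
    ring

theorem sum_stdOrthonormalBasis {x : M} {T : TangentSpace (𝓡 n) x → TangentSpace (𝓡 n) x → ℝ}
    (hT : IsSymmBilin T) (v w : TangentSpace (𝓡 n) x) :
    ∑ i, inner ℝ (stdOrthonormalBasis ℝ (TangentSpace (𝓡 n) x) i) v *
      T (stdOrthonormalBasis ℝ (TangentSpace (𝓡 n) x) i) w = T v w :=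
  hT.sum_repr _ v w

theorem finrank_tangentSpace (x : M) : Module.finrank ℝ (TangentSpace (𝓡 n) x) = n :=
  finrank_euclideanSpace_fin

theorem metricTrace_inner (x : M) :
    metricTrace (𝓡 n) x (fun v w ↦ inner ℝ v w) = n := by
  simp [metricTrace, finrank_tangentSpace x]

namespace ConformalChart

variable (c : ConformalChart n M)

theorem isSymmBilin_schoutenAt {x : M} (hx : x ∈ c.chart.source) :
    IsSymmBilin (c.schoutenAt x) :=
  (isSymmBilin_schouten (c.contDiffAt_expr hx)).comp
    (mfderiv (𝓡 n) (𝓡 n) c.chart x).toLinearMap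

theorem ricci_eq {x : M} (hx : x ∈ c.chart.source) (v w : TangentSpace (𝓡 n) x) :
    ricci (𝓡 n) x v w =
      (2 - n) * c.schoutenAt x v w - metricTrace (𝓡 n) x (c.schoutenAt x) * inner ℝ v w := by
  have hs := c.isSymmBilin_schoutenAt hx
  have h1 := sum_stdOrthonormalBasis hs v w
  have h2 := sum_stdOrthonormalBasis hs w v
  rw [hs.symm w v] at h2
  have h3 := metricTrace_inner (n := n) x
  have h4 : ∀ z : TangentSpace (𝓡 n) x, ∀ i, c.schoutenAt x z
      (stdOrthonormalBasis ℝ (TangentSpace (𝓡 n) x) i) =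
        c.schoutenAt x (stdOrthonormalBasis ℝ (TangentSpace (𝓡 n) x) i) z :=
    fun z i ↦ hs.symm _ _
  have h5 : ∀ z : TangentSpace (𝓡 n) x, ∀ i,
      inner ℝ z (stdOrthonormalBasis ℝ (TangentSpace (𝓡 n) x) i) =
        inner ℝ (stdOrthonormalBasis ℝ (TangentSpace (𝓡 n) x) i) z :=
    fun z i ↦ real_inner_comm _ _
  simp only [ricci, metricTrace, c.riemann_eq hx] at h3 ⊢
  simp only [h4 v, h5 v]
  rw [Finset.sum_sub_distrib, Finset.sum_sub_distrib, Finset.sum_add_distrib, ← Finset.mul_sum,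
    ← Finset.mul_sum, h2, h3]
  simp only [mul_comm (c.schoutenAt x _ w), h1]
  ring

theorem scalarCurvature_eq {x : M} (hx : x ∈ c.chart.source) :
    scalarCurvature (𝓡 n) x =
      -(2 * (n - 1) * metricTrace (𝓡 n) x (c.schoutenAt x)) := by
  have h3 := metricTrace_inner (n := n) x
  rw [scalarCurvature]
  simp only [metricTrace] at h3 ⊢
  simp only [c.ricci_eq hx]
  rw [Finset.sum_sub_distrib, ← Finset.mul_sum, ← Finset.mul_sum, h3, metricTrace]
  ring

/-- Two conformal charts of a manifold of dimension at least three define the same tensor. -/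
theorem schoutenAt_eq_of_three_le (hn : 3 ≤ n) (c' : ConformalChart n M) {x : M}
    (hx : x ∈ c.chart.source) (hx' : x ∈ c'.chart.source) (v w : TangentSpace (𝓡 n) x) :
    c.schoutenAt x v w = c'.schoutenAt x v w := by
  have hn' : (3 : ℝ) ≤ n := by exact_mod_cast hn
  have h1 := (c.scalarCurvature_eq hx).symm.trans (c'.scalarCurvature_eq hx')
  have h2 := (c.ricci_eq hx v w).symm.trans (c'.ricci_eq hx' v w)
  have h3 : metricTrace (𝓡 n) x (c.schoutenAt x) = metricTrace (𝓡 n) x (c'.schoutenAt x) := by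
    refine mul_left_cancel₀ (a := 2 * ((n : ℝ) - 1)) ?_ (neg_injective h1)
    exact ne_of_gt (by linarith)
  rw [h3] at h2
  refine mul_left_cancel₀ (a := 2 - (n : ℝ)) ?_ (by linarith)
  exact ne_of_lt (by linarith)

end ConformalChart

theorem inner_grad (f : M → ℝ) (x : M) (w : TangentSpace (𝓡 n) x) :
    inner ℝ (grad (𝓡 n) f x) w = mvfderiv (𝓡 n) f x w := by
  have h := congrArg (mvfderiv (𝓡 n) f x)
    ((stdOrthonormalBasis ℝ (TangentSpace (𝓡 n) x)).sum_repr' w)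
  rw [map_sum] at h
  rw [← h, grad, sum_inner]
  refine Finset.sum_congr rfl fun i _ ↦ ?_
  rw [real_inner_smul_left, map_smul, smul_eq_mul, mul_comm]

namespace ConformalChart

variable (c : ConformalChart n M)

theorem grad_eq_field {y : M} (hy : y ∈ c.chart.source) {f : M → ℝ}
    {g : EuclideanSpace ℝ (Fin n) → ℝ} (hfg : ∀ᶠ z in 𝓝 y, f z = g (c.chart z))
    (hg : DifferentiableAt ℝ g (c.chart y)) :
    grad (𝓡 n) f y = c.field (fun p ↦ Real.exp (-(2 * c.expr p)) • gradient g p) y := by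
  refine c.ext_inner_field hy fun b ↦ ?_
  rw [inner_grad, c.inner_field hy, c.mvfderiv_comp_chart hy hfg hg, c.mfderiv_field hy,
    real_inner_smul_left, inner_gradient, ← mul_assoc, ← Real.exp_add]
  simp

/-- The Hessian for the metric `e^{2 U} ḡ` in terms of derivatives in a conformal chart. -/
theorem hessian_eq {x : M} (hx : x ∈ c.chart.source) {f : M → ℝ}
    {g : EuclideanSpace ℝ (Fin n) → ℝ} (hfg : ∀ᶠ y in 𝓝 x, f y = g (c.chart y))
    (hg : ContDiffAt ℝ ∞ g (c.chart x)) (v w : TangentSpace (𝓡 n) x)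
    {a b : EuclideanSpace ℝ (Fin n)} (ha : mfderiv (𝓡 n) (𝓡 n) c.chart x v = a)
    (hb : mfderiv (𝓡 n) (𝓡 n) c.chart x w = b) :
    hessian (𝓡 n) f x v w = fderiv ℝ (fderiv ℝ g) (c.chart x) a b
      - fderiv ℝ c.expr (c.chart x) a * fderiv ℝ g (c.chart x) b
      - fderiv ℝ g (c.chart x) a * fderiv ℝ c.expr (c.chart x) b
      + fderiv ℝ c.expr (c.chart x) (gradient g (c.chart x)) * inner ℝ a b := by
  have hU := c.contDiffAt_expr hx
  have hgrad : ∀ᶠ y in 𝓝 x, grad (𝓡 n) f y =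
      c.field (fun p ↦ Real.exp (-(2 * c.expr p)) • gradient g p) y := by
    filter_upwards [hfg.eventually_nhds, c.eventually_mem_source hx,
      (c.chart.continuousAt hx).eventually
        ((hg.of_le (m := 1) (by simp)).eventually (by simp))] with y h1 h2 h3
    exact c.grad_eq_field h2 h1 (h3.differentiableAt (by simp))
  have d1 := ((hU.differentiableAt (by simp)).hasFDerivAt.const_mul 2).fun_neg.exp
  have d2 := ((contDiffAt_gradient hg).differentiableAt (by simp)).hasFDerivAt
  have d := d1.smul d2
  have hv : v = c.field (fun _ ↦ a) x := by rw [← ha, c.field_mfderiv hx]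
  have hw : w = c.field (fun _ ↦ b) x := by rw [← hb, c.field_mfderiv hx]
  rw [hessian, hw, hv, c.leviCivita_eq_field hx d.differentiableAt hgrad, c.inner_field hx, conn,
    d.fderiv, Pi.smul_apply']
  have he : Real.exp (2 * c.expr (c.chart x)) * Real.exp (-(2 * c.expr (c.chart x))) = 1 := by
    rw [← Real.exp_add]; simp
  simp only [FunLike.coe_add, FunLike.coe_smul, Pi.add_apply, Pi.smul_apply,
    ContinuousLinearMap.smulRight_apply, map_smul,
    inner_add_left, inner_sub_left, real_inner_smul_left, real_inner_smul_right, inner_gradient,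
    inner_fderiv_gradient hg, smul_eq_mul, FunLike.coe_neg, Pi.neg_apply]
  rw [real_inner_comm (gradient g (c.chart x)) a, inner_gradient]
  linear_combination (fderiv ℝ (fderiv ℝ g) (c.chart x) a b
      - fderiv ℝ c.expr (c.chart x) a * fderiv ℝ g (c.chart x) b
      - fderiv ℝ g (c.chart x) a * fderiv ℝ c.expr (c.chart x) b
      + fderiv ℝ c.expr (c.chart x) (gradient g (c.chart x)) * inner ℝ a b) * he

end ConformalChart

/-- The identity chart of Euclidean space. -/
noncomputable def euclideanChart (n : ℕ) : ConformalChart n (EuclideanSpace ℝ (Fin n)) where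
  chart := OpenPartialHomeomorph.refl _
  mem_maximalAtlas := by
    simpa only [chartAt_self_eq] using IsManifold.chart_mem_maximalAtlas (I := 𝓡 n) (n := ∞)
      (0 : EuclideanSpace ℝ (Fin n))
  factor := 0
  contMDiffOn_factor := contMDiffOn_const
  conformal x _ v w := by
    rw [show mfderiv (𝓡 n) (𝓡 n) (OpenPartialHomeomorph.refl (EuclideanSpace ℝ (Fin n))) x =
      ContinuousLinearMap.id ℝ _ from mfderiv_id]
    simp
    rfl

theorem hessian_euclidean {U : EuclideanSpace ℝ (Fin n) → ℝ} {p : EuclideanSpace ℝ (Fin n)}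
    (hU : ContDiffAt ℝ ∞ U p) (v w : EuclideanSpace ℝ (Fin n)) :
    hessian (𝓡 n) U p v w = fderiv ℝ (fderiv ℝ U) p v w := by
  have h1 : mfderiv (𝓡 n) (𝓡 n) (euclideanChart n).chart p = ContinuousLinearMap.id ℝ _ :=
    mfderiv_id
  have h2 : (euclideanChart n).expr = fun _ ↦ 0 := rfl
  have h := (euclideanChart n).hessian_eq (x := p) (Set.mem_univ _) (f := U) (g := U)
    (Filter.Eventually.of_forall fun _ ↦ rfl) hU v w (a := v) (b := w)
    (congrArg (fun L ↦ L v) h1) (congrArg (fun L ↦ L w) h1)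
  rw [h2] at h
  simpa using! h

theorem grad_euclidean {U : EuclideanSpace ℝ (Fin n) → ℝ} (p : EuclideanSpace ℝ (Fin n)) :
    grad (𝓡 n) U p = gradient U p := by
  refine ext_inner_right ℝ fun w ↦ ?_
  rw [inner_grad, mvfderiv, mfderiv_eq_fderiv]
  exact (inner_gradient U p w).symm
namespace ConformalChart

variable (c : ConformalChart n M)

theorem metricTrace_schoutenAt {x : M} (hx : x ∈ c.chart.source) (v w : TangentSpace (𝓡 n) x) :
    metricTrace (𝓡 n) (c.chart x) (schouten c.expr (c.chart x)) *
      inner ℝ (mfderiv (𝓡 n) (𝓡 n) c.chart x v) (mfderiv (𝓡 n) (𝓡 n) c.chart x w) =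
    metricTrace (𝓡 n) x (c.schoutenAt x) * inner ℝ v w := by
  set L := mfderiv (𝓡 n) (𝓡 n) c.chart x
  set e := stdOrthonormalBasis ℝ (TangentSpace (𝓡 n) x)
  set f := stdOrthonormalBasis ℝ (TangentSpace (𝓡 n) (c.chart x))
  set r := Real.exp (2 * c.factor x)
  have hinner : ∀ v w : TangentSpace (𝓡 n) x, inner ℝ v w = r * inner ℝ (L v) (L w) :=
    c.conformal x hx
  have hT : IsSymmBilin (V := TangentSpace (𝓡 n) (c.chart x)) (schouten c.expr (c.chart x)) :=
    isSymmBilin_schouten (c.contDiffAt_expr hx)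
  have hS := c.isSymmBilin_schoutenAt hx
  choose g hg using fun j ↦ (c.isInvertible_mfderiv hx).surjective (f j)
  have h1 : ∀ i, r * c.schoutenAt x (e i) (e i) =
      ∑ j, inner ℝ (e i) (g j) * c.schoutenAt x (e i) (g j) := by
    intro i
    have h : ∑ j, inner ℝ (f j) (L (e i)) * schouten c.expr (c.chart x) (f j) (L (e i)) =
      c.schoutenAt x (e i) (e i) := hT.sum_repr f _ _
    rw [← h, Finset.mul_sum]
    refine Finset.sum_congr rfl fun j _ ↦ ?_
    rw [real_inner_comm, hinner, hS.symm (e i) (g j), hg j]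
    have h3 : c.schoutenAt x (g j) (e i) = schouten c.expr (c.chart x) (f j) (L (e i)) := by
      rw [← hg j]; rfl
    rw [h3, mul_assoc]
  have h2 : metricTrace (𝓡 n) (c.chart x) (schouten c.expr (c.chart x)) =
      r * metricTrace (𝓡 n) x (c.schoutenAt x) := by
    change ∑ j, schouten c.expr (c.chart x) (f j) (f j) = r * ∑ i, c.schoutenAt x (e i) (e i)
    rw [Finset.mul_sum, Finset.sum_congr rfl fun i _ ↦ h1 i, Finset.sum_comm]
    refine Finset.sum_congr rfl fun j _ ↦ ?_
    rw [hS.sum_repr e]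
    rw [← hg j]
    rfl
  rw [h2, hinner]
  ring

end ConformalChart

theorem osgoodStowe_euclidean {U : EuclideanSpace ℝ (Fin n) → ℝ} {p : EuclideanSpace ℝ (Fin n)}
    (hU : ContDiffAt ℝ ∞ U p) (hn : n ≠ 0) (v w : TangentSpace (𝓡 n) p) :
    osgoodStowe (𝓡 n) U p v w = schouten U p v w
      - 1 / (n : ℝ) * (metricTrace (𝓡 n) p (schouten U p) * inner ℝ v w) := by
  have hd : ∀ z : TangentSpace (𝓡 n) p, mvfderiv (𝓡 n) U p z = fderiv ℝ U p z := by
    intro z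
    rw [mvfderiv, mfderiv_eq_fderiv]
    rfl
  set κ := fderiv ℝ U p (gradient U p)
  have hs : ∀ a b : TangentSpace (𝓡 n) p, schouten U p a b =
      hessian (𝓡 n) U p a b - mvfderiv (𝓡 n) U p a * mvfderiv (𝓡 n) U p b
        + 2⁻¹ * κ * inner ℝ a b := by
    intro a b
    rw [hd, hd]
    exact congrArg (fun t ↦ t - _ + _) (hessian_euclidean hU a b).symm
  set e := stdOrthonormalBasis ℝ (TangentSpace (𝓡 n) p)
  have h4 : inner ℝ (grad (𝓡 n) U p) (grad (𝓡 n) U p) = κ := by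
    rw [inner_grad, hd, grad_euclidean]
  have h1 : ∑ i, mvfderiv (𝓡 n) U p (e i) * mvfderiv (𝓡 n) U p (e i) = κ := by
    have h := e.sum_inner_mul_inner (grad (𝓡 n) U p) (grad (𝓡 n) U p)
    simp only [real_inner_comm (grad (𝓡 n) U p), inner_grad] at h
    rw [h, h4]
  have h2 := metricTrace_inner (n := n) p
  have h3 : metricTrace (𝓡 n) p (schouten U p) = laplacian (𝓡 n) U p - κ + 2⁻¹ * κ * n := by
    rw [laplacian, ← h2]
    simp only [metricTrace]
    rw [Finset.mul_sum]
    nth_rewrite 1 [← h1]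
    rw [← Finset.sum_sub_distrib, ← Finset.sum_add_distrib]
    exact Finset.sum_congr rfl fun i _ ↦ hs _ _
  rw [osgoodStowe, h3, h4, hs, finrank_euclideanSpace_fin]
  have hn' : (n : ℝ) ≠ 0 := by exact_mod_cast hn
  field_simp
  ring

namespace ConformalChart

variable (c : ConformalChart n M)

theorem osgoodStowe_eq (hn : n ≠ 0) {x : M} (hx : x ∈ c.chart.source)
    (v w : TangentSpace (𝓡 n) x) :
    c.osgoodStowe x v w = c.schoutenAt x v w
      - 1 / (n : ℝ) * (metricTrace (𝓡 n) x (c.schoutenAt x) * inner ℝ v w) := by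
  rw [← c.metricTrace_schoutenAt hx]
  exact osgoodStowe_euclidean (c.contDiffAt_expr hx) hn _ _

end ConformalChart

theorem IsShapeOperatorAtInfinity.inner_eq {A : Set (ConformalChart n M)}
    {B : Π x : M, TangentSpace (𝓡 n) x →L[ℝ] TangentSpace (𝓡 n) x}
    (hB : IsShapeOperatorAtInfinity A B) (hn : 2 ≤ n)
    (hA : ∀ c ∈ A, ∀ c' ∈ A, ∀ x ∈ c.chart.source, x ∈ c'.chart.source →
      ∀ v w, c.schoutenAt x v w = c'.schoutenAt x v w)
    {c : ConformalChart n M} (hc : c ∈ A) {x : M} (hx : x ∈ c.chart.source)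
    (v w : TangentSpace (𝓡 n) x) : inner ℝ (B x v) w = 2 * c.schoutenAt x v w := by
  have h : ∃ c ∈ A, x ∈ c.chart.source := ⟨c, hc, hx⟩
  have hn' : (2 : ℝ) ≤ n := by exact_mod_cast hn
  rw [hB, osgoodStoweOf, dif_pos h, h.choose.osgoodStowe_eq (by omega) h.choose_spec.2,
    h.choose.scalarCurvature_eq h.choose_spec.2,
    hA c hc h.choose h.choose_spec.1 x hx h.choose_spec.2]
  have h1 : (n : ℝ) - 1 ≠ 0 := by linarith
  have h2 : (n : ℝ) ≠ 0 := by linarith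
  field_simp
  ring

section Calculus

variable {U : EuclideanSpace ℝ (Fin n) → ℝ}
  {G : EuclideanSpace ℝ (Fin n) → EuclideanSpace ℝ (Fin n)} {p : EuclideanSpace ℝ (Fin n)}

/-- The coordinate expression of `B G`, where `e^{2 U} ḡ (B ·, ·) = 2 schouten U`. -/
noncomputable def shapeField (U : EuclideanSpace ℝ (Fin n) → ℝ)
    (G : EuclideanSpace ℝ (Fin n) → EuclideanSpace ℝ (Fin n)) (p : EuclideanSpace ℝ (Fin n)) :
    EuclideanSpace ℝ (Fin n) :=
  (2 * Real.exp (-(2 * U p))) • (fderiv ℝ (gradient U) p (G p) - fderiv ℝ U p (G p) • gradient U p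
    + (2⁻¹ * fderiv ℝ U p (gradient U p)) • G p)

theorem inner_shapeField (hU : ContDiffAt ℝ ∞ U p) (w : EuclideanSpace ℝ (Fin n)) :
    inner ℝ (shapeField U G p) w = Real.exp (-(2 * U p)) * (2 * schouten U p (G p) w) := by
  simp only [shapeField, schouten, inner_add_left, inner_sub_left, real_inner_smul_left,
    inner_gradient, inner_fderiv_gradient hU]
  ring

theorem differentiableAt_shapeField (hU : ContDiffAt ℝ ∞ U p) (hG : DifferentiableAt ℝ G p) :
    DifferentiableAt ℝ (shapeField U G) p := by
  have h1 := (hU.fderiv_right (m := ∞) (by simp)).differentiableAt (by simp)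
  have h2 := (contDiffAt_gradient hU).differentiableAt (by simp)
  have h3 := ((contDiffAt_gradient hU).fderiv_right (m := ∞) (by simp)).differentiableAt (by simp)
  have h4 := ((hU.differentiableAt (by simp)).const_mul 2).fun_neg.exp.const_mul 2
  exact h4.smul (((h3.clm_apply hG).sub ((h1.clm_apply hG).smul h2)).add
    (((h1.clm_apply h2).const_mul 2⁻¹).smul hG))

theorem inner_fderiv_shapeField (hU : ContDiffAt ℝ ∞ U p) (b v w : EuclideanSpace ℝ (Fin n)) :
    inner ℝ (fderiv ℝ (shapeField U fun _ ↦ b) p v) w = 2 * Real.exp (-(2 * U p)) *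
      (inner ℝ (fderiv ℝ (fderiv ℝ (gradient U)) p v b) w
        - fderiv ℝ (fderiv ℝ U) p v b * fderiv ℝ U p w
        - fderiv ℝ U p b * fderiv ℝ (fderiv ℝ U) p v w
        + fderiv ℝ (fderiv ℝ U) p v (gradient U p) * inner ℝ b w
        - 2 * fderiv ℝ U p v * schouten U p b w) := by
  have h0 := (hU.differentiableAt (by simp)).hasFDerivAt
  have h1 := ((hU.fderiv_right (m := ∞) (by simp)).differentiableAt (by simp)).hasFDerivAt
  have h2 := ((contDiffAt_gradient hU).differentiableAt (by simp)).hasFDerivAt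
  have h3 := (((contDiffAt_gradient hU).fderiv_right (m := ∞) (by simp)).differentiableAt
    (by simp)).hasFDerivAt
  have hb := hasFDerivAt_const (𝕜 := ℝ) b p
  have h4 := (h0.const_mul 2).fun_neg.exp.const_mul 2
  have h := h4.smul (((h3.clm_apply hb).sub ((h1.clm_apply hb).smul h2)).add
    (((h1.clm_apply h2).const_mul 2⁻¹).smul hb))
  have h5 : fderiv ℝ U p (fderiv ℝ (gradient U) p v) =
      fderiv ℝ (fderiv ℝ U) p v (gradient U p) := by
    rw [← inner_gradient, real_inner_comm, inner_fderiv_gradient hU]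
  rw [show fderiv ℝ (shapeField U fun _ ↦ b) p = _ from h.fderiv]
  simp [schouten, inner_add_left, inner_sub_left, real_inner_smul_left, inner_fderiv_gradient hU,
    h5]
  ring

/-- The Codazzi equation in coordinates. -/
theorem conn_shapeField_comm (hU : ContDiffAt ℝ ∞ U p) (a b : EuclideanSpace ℝ (Fin n)) :
    conn U (fun _ ↦ a) (shapeField U fun _ ↦ b) p =
      conn U (fun _ ↦ b) (shapeField U fun _ ↦ a) p := by
  refine ext_inner_right ℝ fun w ↦ ?_
  have s1 := fderiv_fderiv_comm (contDiffAt_gradient hU) a b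
  have s2 := fderiv_fderiv_comm hU a b
  have s3 := fderiv_fderiv_comm hU (gradient U p)
  have e1 : ∀ z, fderiv ℝ U p (shapeField U (fun _ ↦ z) p) =
      Real.exp (-(2 * U p)) * (2 * schouten U p z (gradient U p)) := fun z ↦ by
    rw [← inner_shapeField (G := fun _ ↦ z) hU, real_inner_comm, inner_gradient]
  have e2 : ∀ y z, inner ℝ y (shapeField U (fun _ ↦ z) p) =
      Real.exp (-(2 * U p)) * (2 * schouten U p z y) := fun y z ↦ by
    rw [← inner_shapeField (G := fun _ ↦ z) hU, real_inner_comm]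
  simp only [conn, inner_add_left, inner_sub_left, real_inner_smul_left, inner_gradient,
    inner_fderiv_shapeField hU, inner_shapeField hU, e1, e2]
  simp only [schouten, s1, s2, real_inner_comm (gradient U p), inner_gradient,
    real_inner_comm a b]
  ring

end Calculus

namespace ConformalChart

variable (c : ConformalChart n M)

theorem apply_field_eq {B : Π x : M, TangentSpace (𝓡 n) x →L[ℝ] TangentSpace (𝓡 n) x}
    (hB : ∀ x ∈ c.chart.source, ∀ v w : TangentSpace (𝓡 n) x,
      inner ℝ (B x v) w = 2 * c.schoutenAt x v w) {y : M} (hy : y ∈ c.chart.source)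
    (G : EuclideanSpace ℝ (Fin n) → EuclideanSpace ℝ (Fin n)) :
    B y (c.field G y) = c.field (shapeField c.expr G) y := by
  refine c.ext_inner_field hy fun b ↦ ?_
  rw [hB y hy, c.inner_field hy, inner_shapeField (c.contDiffAt_expr hy), ← mul_assoc (Real.exp _),
    ← Real.exp_add, schoutenAt, c.mfderiv_field hy, c.mfderiv_field hy]
  simp

theorem mdiffFieldAt_apply {B : Π x : M, TangentSpace (𝓡 n) x →L[ℝ] TangentSpace (𝓡 n) x}
    (hB : ∀ x ∈ c.chart.source, ∀ v w : TangentSpace (𝓡 n) x,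
      inner ℝ (B x v) w = 2 * c.schoutenAt x v w) {x : M} (hx : x ∈ c.chart.source)
    {X : Π x : M, TangentSpace (𝓡 n) x} (hX : MDiffFieldAt (𝓡 n) X x) :
    MDiffFieldAt (𝓡 n) (fun y ↦ B y (X y)) x := by
  have hU := c.contDiffAt_expr hx
  set e := EuclideanSpace.basisFun (Fin n) ℝ
  let f : Fin n → M → ℝ := fun i y ↦
    inner ℝ (c.field (fun p ↦ Real.exp (-(2 * c.expr p)) • e i) y) (X y)
  have hf : ∀ i, MDifferentiableAt (𝓡 n) 𝓘(ℝ, ℝ) (f i) x := fun i ↦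
    mdifferentiableAt_inner (𝓡 n) (c.mdifferentiableAt_field hx
      (((hU.differentiableAt (by simp)).const_mul 2).fun_neg.exp.smul_const (e i))) hX
  have hfe : ∀ y ∈ c.chart.source, X y = ∑ i, f i y • c.field (fun _ ↦ e i) y := by
    intro y hy
    refine c.mfderiv_chart_injective hy ?_
    rw [map_sum]
    have h1 : ∀ i, f i y = inner ℝ (e i) (mfderiv (𝓡 n) (𝓡 n) c.chart y (X y)) := fun i ↦ by
      obtain ⟨z, hz⟩ : ∃ z : EuclideanSpace ℝ (Fin n), c.field (fun _ ↦ z) y = X y :=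
        ⟨_, c.field_mfderiv hy _⟩
      change inner ℝ _ (X y) = _
      rw [← hz, c.inner_field hy, real_inner_smul_left, ← mul_assoc,
        ← Real.exp_add, c.mfderiv_field hy]
      simp
    refine (e.sum_repr' _).symm.trans (Finset.sum_congr rfl fun i _ ↦ ?_)
    rw [map_smul, c.mfderiv_field hy, h1]
    rfl
  have hsum : MDiffFieldAt (𝓡 n)
      (fun y ↦ ∑ i, f i y • c.field (shapeField c.expr fun _ ↦ e i) y) x :=
    MDifferentiableAt.sum_section fun i _ ↦ (hf i).smul_section
      (c.mdifferentiableAt_field hx (differentiableAt_shapeField hU (differentiableAt_const _)))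
  refine mdiffFieldAt_congr hsum ((c.eventually_mem_source hx).mono fun y hy ↦ ?_)
  rw [hfe y hy, map_sum]
  refine Finset.sum_congr rfl fun i _ ↦ ?_
  rw [map_smul, c.apply_field_eq hB hy]

theorem extCovDeriv_field {B : Π x : M, TangentSpace (𝓡 n) x →L[ℝ] TangentSpace (𝓡 n) x}
    (hB : ∀ x ∈ c.chart.source, ∀ v w : TangentSpace (𝓡 n) x,
      inner ℝ (B x v) w = 2 * c.schoutenAt x v w) {x : M} (hx : x ∈ c.chart.source)
    (a b : EuclideanSpace ℝ (Fin n)) :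
    extCovDeriv (𝓡 n) B (c.field fun _ ↦ a) (c.field fun _ ↦ b) x = 0 := by
  have hU := c.contDiffAt_expr hx
  have h : ∀ z, ∀ᶠ y in 𝓝 x, B y (c.field (fun _ ↦ z) y) =
      c.field (shapeField c.expr fun _ ↦ z) y := fun z ↦
    (c.eventually_mem_source hx).mono fun y hy ↦ c.apply_field_eq hB hy _
  have hd : ∀ z, DifferentiableAt ℝ (shapeField c.expr fun _ ↦ z) (c.chart x) := fun z ↦
    differentiableAt_shapeField hU (differentiableAt_const z)
  rw [extCovDeriv, c.leviCivita_eq_field hx (hd b) (h b),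
    c.leviCivita_eq_field hx (hd a) (h a),
    c.mlieBracket_field hx (differentiableAt_const a) (differentiableAt_const b),
    c.field_congr (conn_shapeField_comm hU a b)]
  have h0 : c.field (fun p ↦ fderiv ℝ (fun _ ↦ b) p a - fderiv ℝ (fun _ ↦ a) p b) x = 0 := by
    refine c.mfderiv_chart_injective hx ?_
    rw [c.mfderiv_field hx, map_zero]
    simp
    rfl
  rw [h0]
  simp

end ConformalChart

section Tensoriality

variable {B : Π x : M, TangentSpace (𝓡 n) x →L[ℝ] TangentSpace (𝓡 n) x} {x : M}

theorem extCovDeriv_swap (X Y : Π x : M, TangentSpace (𝓡 n) x) :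
    extCovDeriv (𝓡 n) B X Y x = -extCovDeriv (𝓡 n) B Y X x := by
  rw [extCovDeriv, extCovDeriv, mlieBracket_swap_apply, map_neg]
  abel

theorem tensorialAt_extCovDeriv (hB : ∀ X : Π x : M, TangentSpace (𝓡 n) x,
      MDiffFieldAt (𝓡 n) X x → MDiffFieldAt (𝓡 n) (fun y ↦ B y (X y)) x)
    (Y : Π x : M, TangentSpace (𝓡 n) x) :
    TensorialAt (𝓡 n) (EuclideanSpace ℝ (Fin n)) (fun X ↦ extCovDeriv (𝓡 n) B X Y x) x where
  smul {f X} hf hX := by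
    have h1 : (fun y ↦ B y ((f • X) y)) = f • fun y ↦ B y (X y) := by
      ext y; simp
    have h2 := (koszulCov_isCov (𝓡 n) (M := M)).leibniz (hB X hX) hf
    simp only [extCovDeriv, h1]
    rw [show leviCivita (𝓡 n) (f • fun y ↦ B y (X y)) x = _ from h2,
      mlieBracket_smul_left hf hX]
    simp only [leviCivita, Pi.smul_apply', map_smul, map_add, FunLike.coe_add,
      FunLike.coe_smul, Pi.add_apply, Pi.smul_apply, ContinuousLinearMap.smulRight_apply]
    module
  add {X X'} hX hX' := by
    have h1 : (fun y ↦ B y ((X + X') y)) = (fun y ↦ B y (X y)) + fun y ↦ B y (X' y) := by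
      ext y; simp
    have h2 := (koszulCov_isCov (𝓡 n) (M := M)).add (hB X hX) (hB X' hX')
    simp only [extCovDeriv, h1]
    rw [show leviCivita (𝓡 n) ((fun y ↦ B y (X y)) + fun y ↦ B y (X' y)) x = _ from h2,
      mlieBracket_add_left hX hX']
    simp only [leviCivita, Pi.add_apply, map_add, FunLike.coe_add]
    abel

theorem tensorialAt_extCovDeriv_right (hB : ∀ X : Π x : M, TangentSpace (𝓡 n) x,
      MDiffFieldAt (𝓡 n) X x → MDiffFieldAt (𝓡 n) (fun y ↦ B y (X y)) x)
    (X : Π x : M, TangentSpace (𝓡 n) x) :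
    TensorialAt (𝓡 n) (EuclideanSpace ℝ (Fin n)) (fun Y ↦ extCovDeriv (𝓡 n) B X Y x) x where
  smul {f Y} hf hY := by
    have h := (tensorialAt_extCovDeriv hB X).smul hf hY
    rw [extCovDeriv_swap X (f • Y), extCovDeriv_swap X Y, h, smul_neg]
  add {Y Y'} hY hY' := by
    have h := (tensorialAt_extCovDeriv hB X).add hY hY'
    rw [extCovDeriv_swap X (Y + Y'), extCovDeriv_swap X Y, extCovDeriv_swap X Y', h, neg_add]

end Tensoriality

theorem solvesCodazzi_of_inner_eq
    {B : Π x : M, TangentSpace (𝓡 n) x →L[ℝ] TangentSpace (𝓡 n) x}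
    (h : ∀ x : M, ∃ c : ConformalChart n M, x ∈ c.chart.source ∧
      ∀ y ∈ c.chart.source, ∀ v w : TangentSpace (𝓡 n) y,
        inner ℝ (B y v) w = 2 * c.schoutenAt y v w) : SolvesCodazzi (𝓡 n) B := by
  have hd : ∀ (x : M) (X : Π x : M, TangentSpace (𝓡 n) x), MDiffFieldAt (𝓡 n) X x →
      MDiffFieldAt (𝓡 n) (fun y ↦ B y (X y)) x := by
    intro x X hX
    obtain ⟨c, hx, hc⟩ := h x
    exact c.mdiffFieldAt_apply hc hx hX
  refine ⟨hd, fun x X Y hX hY ↦ ?_⟩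
  obtain ⟨c, hx, hc⟩ := h x
  rw [← c.extCovDeriv_field hc hx (mfderiv (𝓡 n) (𝓡 n) c.chart x (X x))
    (mfderiv (𝓡 n) (𝓡 n) c.chart x (Y x))]
  exact TensorialAt.pointwise₂ (Φ := fun X Y ↦ extCovDeriv (𝓡 n) B X Y x)
    (fun Y _ ↦ tensorialAt_extCovDeriv (hd x) Y)
    (fun X _ ↦ tensorialAt_extCovDeriv_right (hd x) X) hX
    (c.mdifferentiableAt_field hx (differentiableAt_const _)) hY
    (c.mdifferentiableAt_field hx (differentiableAt_const _))
    (c.field_mfderiv hx _).symm (c.field_mfderiv hx _).symm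

namespace ConformalChart

variable (c : ConformalChart n M)

/-- The difference of the tensors of two conformal charts, up to multiples of the metric. -/
theorem exists_schoutenAt_sub_eq (c' : ConformalChart n M) {x : M} (hx : x ∈ c.chart.source)
    (hx' : x ∈ c'.chart.source) {W : EuclideanSpace ℝ (Fin n) → ℝ}
    (hW : ContDiffAt ℝ ∞ W (c.chart x))
    (hcW : ∀ᶠ y in 𝓝 x, c.factor y - c'.factor y = W (c.chart y)) :
    ∃ μ : ℝ, ∀ v w : TangentSpace (𝓡 n) x, c.schoutenAt x v w - c'.schoutenAt x v w =
      fderiv ℝ (fderiv ℝ W) (c.chart x) (mfderiv (𝓡 n) (𝓡 n) c.chart x v)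
        (mfderiv (𝓡 n) (𝓡 n) c.chart x w)
      - fderiv ℝ W (c.chart x) (mfderiv (𝓡 n) (𝓡 n) c.chart x v)
        * fderiv ℝ W (c.chart x) (mfderiv (𝓡 n) (𝓡 n) c.chart x w) + μ * inner ℝ v w := by
  have hU := c.contDiffAt_expr hx
  have hU' := c'.contDiffAt_expr hx'
  set p := c.chart x with hp
  set q := c'.chart x with hq
  set G : EuclideanSpace ℝ (Fin n) → ℝ := fun r ↦ c.expr r - W r with hGdef
  have hG : ContDiffAt ℝ ∞ G p := hU.sub hW
  have f1 : ∀ᶠ y in 𝓝 x, c'.factor y = G (c.chart y) := by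
    filter_upwards [hcW, c.eventually_mem_source hx] with y h1 h2
    rw [hGdef]
    simp only
    rw [← h1, expr, Function.comp_apply, c.chart.left_inv h2]
    ring
  have f2 : ∀ᶠ y in 𝓝 x, c'.factor y = c'.expr (c'.chart y) := by
    filter_upwards [c'.eventually_mem_source hx'] with y h2
    rw [expr, Function.comp_apply, c'.chart.left_inv h2]
  have g1 : fderiv ℝ G p = fderiv ℝ c.expr p - fderiv ℝ W p :=
    fderiv_sub (hU.differentiableAt (by simp)) (hW.differentiableAt (by simp))
  have g2 : fderiv ℝ (fderiv ℝ G) p = fderiv ℝ (fderiv ℝ c.expr) p - fderiv ℝ (fderiv ℝ W) p := by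
    have h : fderiv ℝ G =ᶠ[𝓝 p] fun r ↦ fderiv ℝ c.expr r - fderiv ℝ W r := by
      filter_upwards [(hU.of_le (m := 1) (by simp)).eventually (by simp),
        (hW.of_le (m := 1) (by simp)).eventually (by simp)] with r h1 h2
      exact fderiv_sub (h1.differentiableAt (by simp)) (h2.differentiableAt (by simp))
    rw [h.fderiv_eq]
    exact fderiv_sub ((hU.fderiv_right (m := ∞) (by simp)).differentiableAt (by simp))
      ((hW.fderiv_right (m := ∞) (by simp)).differentiableAt (by simp))
  set r := Real.exp (2 * c.factor x) with hr
  set r' := Real.exp (2 * c'.factor x) with hr'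
  have hr0 : r ≠ 0 := (Real.exp_pos _).ne'
  have hr0' : r' ≠ 0 := (Real.exp_pos _).ne'
  refine ⟨r⁻¹ * (2⁻¹ * fderiv ℝ c.expr p (gradient c.expr p) - fderiv ℝ c.expr p (gradient G p))
    + r'⁻¹ * (2⁻¹ * fderiv ℝ c'.expr q (gradient c'.expr q)), fun v w ↦ ?_⟩
  obtain ⟨a, ha⟩ : ∃ a : EuclideanSpace ℝ (Fin n), mfderiv (𝓡 n) (𝓡 n) c.chart x v = a := ⟨_, rfl⟩
  obtain ⟨b, hb⟩ : ∃ b : EuclideanSpace ℝ (Fin n), mfderiv (𝓡 n) (𝓡 n) c.chart x w = b := ⟨_, rfl⟩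
  obtain ⟨a', ha'⟩ : ∃ a : EuclideanSpace ℝ (Fin n), mfderiv (𝓡 n) (𝓡 n) c'.chart x v = a :=
    ⟨_, rfl⟩
  obtain ⟨b', hb'⟩ : ∃ b : EuclideanSpace ℝ (Fin n), mfderiv (𝓡 n) (𝓡 n) c'.chart x w = b :=
    ⟨_, rfl⟩
  have hv : fderiv ℝ G p a = fderiv ℝ c'.expr q a' := by
    rw [← ha, ← ha']
    exact (c.mvfderiv_comp_chart hx f1 (hG.differentiableAt (by simp)) v).symm.trans
      (c'.mvfderiv_comp_chart hx' f2 (hU'.differentiableAt (by simp)) v)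
  have hw : fderiv ℝ G p b = fderiv ℝ c'.expr q b' := by
    rw [← hb, ← hb']
    exact (c.mvfderiv_comp_chart hx f1 (hG.differentiableAt (by simp)) w).symm.trans
      (c'.mvfderiv_comp_chart hx' f2 (hU'.differentiableAt (by simp)) w)
  have hess := (c.hessian_eq hx f1 hG v w ha hb).symm.trans
    (c'.hessian_eq hx' f2 hU' v w ha' hb')
  have i1 : r⁻¹ * inner ℝ v w = inner ℝ a b := by
    rw [c.conformal x hx v w, ← hr, inv_mul_cancel_left₀ hr0, ← ha, ← hb]
    rfl
  have i2 : r'⁻¹ * inner ℝ v w = inner ℝ a' b' := by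
    rw [c'.conformal x hx' v w, ← hr', inv_mul_cancel_left₀ hr0', ← ha', ← hb']
    rfl
  have s1 : c.schoutenAt x v w = schouten c.expr p a b := by rw [← ha, ← hb]; rfl
  have s2 : c'.schoutenAt x v w = schouten c'.expr q a' b' := by rw [← ha', ← hb']; rfl
  rw [s1, s2, ha, hb, schouten, schouten]
  simp only [← hp, ← hq, ← hv, ← hw, g1, g2, sub_apply] at hess ⊢
  linear_combination hess
    - (2⁻¹ * fderiv ℝ c.expr p (gradient c.expr p) - fderiv ℝ c.expr p (gradient G p)) * i1
    - 2⁻¹ * fderiv ℝ c'.expr q (gradient c'.expr q) * i2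

end ConformalChart

theorem fderiv_fderiv_sub_of_exp_neg {U Q : EuclideanSpace ℝ (Fin n) → ℝ}
    {p : EuclideanSpace ℝ (Fin n)} (hU : ContDiffAt ℝ ∞ U p)
    (hQ : ∀ᶠ q in 𝓝 p, Real.exp (-U q) = Q q) (a b : EuclideanSpace ℝ (Fin n)) :
    fderiv ℝ (fderiv ℝ U) p a b - fderiv ℝ U p a * fderiv ℝ U p b =
      -(Real.exp (U p) * fderiv ℝ (fderiv ℝ Q) p a b) := by
  have h1 : fderiv ℝ Q =ᶠ[𝓝 p] fun q ↦ Real.exp (-U q) • -fderiv ℝ U q := by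
    filter_upwards [hQ.eventually_nhds, (hU.of_le (m := 1) (by simp)).eventually (by simp)]
      with q h1 h2
    rw [← Filter.EventuallyEq.fderiv_eq h1]
    exact ((h2.differentiableAt (by simp)).hasFDerivAt.fun_neg.exp).fderiv
  have h2 := (hU.differentiableAt (by simp)).hasFDerivAt.fun_neg.exp.smul
    ((hU.fderiv_right (m := ∞) (by simp)).differentiableAt (by simp)).hasFDerivAt.fun_neg
  rw [h1.fderiv_eq, show fderiv ℝ (fun q ↦ Real.exp (-U q) • -fderiv ℝ U q) p = _ from h2.fderiv]
  have h3 : Real.exp (U p) * Real.exp (-U p) = 1 := by rw [← Real.exp_add]; simp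
  simp
  linear_combination (-fderiv ℝ (fderiv ℝ U) p a b + fderiv ℝ U p a * fderiv ℝ U p b) * h3

/-- The identification of `ℝ²` with `ℂ` as a continuous linear map. -/
noncomputable def toComplexL (hn : n = 2) : EuclideanSpace ℝ (Fin n) →L[ℝ] ℂ :=
  LinearMap.toContinuousLinearMap
    { toFun := toComplex hn
      map_add' := fun _ _ ↦ by apply Complex.ext <;> simp [toComplex]
      map_smul' := fun _ _ ↦ by apply Complex.ext <;> simp [toComplex] }

theorem toComplexL_apply (hn : n = 2) (p : EuclideanSpace ℝ (Fin n)) :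
    toComplexL hn p = toComplex hn p := rfl

theorem norm_toComplex (hn : n = 2) (p : EuclideanSpace ℝ (Fin n)) :
    ‖toComplex hn p‖ = ‖p‖ := by
  subst hn
  rw [Complex.norm_eq_sqrt_sq_add_sq, EuclideanSpace.norm_eq]
  simp [toComplex, Fin.sum_univ_two]

theorem inner_toComplex (hn : n = 2) (p q : EuclideanSpace ℝ (Fin n)) :
    inner ℝ (toComplex hn p) (toComplex hn q) = inner ℝ p q := by
  subst hn
  rw [PiLp.inner_apply]
  simp [toComplex, Fin.sum_univ_two, Complex.inner]

theorem fderiv_fderiv_norm_sq {E F : Type*} [NormedAddCommGroup E] [NormedSpace ℝ E]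
    [NormedAddCommGroup F] [InnerProductSpace ℝ F] (L : E →L[ℝ] F) (z : F) (K : ℝ) (p a b : E) :
    fderiv ℝ (fderiv ℝ fun q ↦ K * ‖L q + z‖ ^ 2) p a b = 2 * K * inner ℝ (L a) (L b) := by
  have h1 : ∀ q, HasFDerivAt (fun q ↦ L q + z) L q := fun q ↦ L.hasFDerivAt.add_const z
  have h2 : (fderiv ℝ fun q ↦ K * ‖L q + z‖ ^ 2) =
      fun q ↦ (2 * K) • (innerSL ℝ (L q + z)).comp L := by
    funext q
    rw [((h1 q).norm_sq.const_mul K).fderiv]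
    ext v
    simp
    ring
  let T : F →L[ℝ] E →L[ℝ] ℝ :=
    (2 * K) • ((ContinuousLinearMap.compL ℝ E F ℝ).flip L).comp (innerSL ℝ)
  have h3 : HasFDerivAt (fun q ↦ (2 * K) • (innerSL ℝ (L q + z)).comp L) (T.comp L) p :=
    T.hasFDerivAt.comp p (h1 p)
  rw [h2, h3.fderiv]
  rfl

namespace ConformalChart

variable (c : ConformalChart n M)

/-- The change of the conformal factor under a Möbius change of conformal charts. -/
theorem exp_factor_sub_of_mobius (hn : n = 2) (c' : ConformalChart n M) {y : M}
    (hy : y ∈ c.chart.source) (hy' : y ∈ c'.chart.source) {α β γ δ : ℂ}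
    (hdet : α * δ - β * γ ≠ 0)
    (h : ∀ᶠ z in 𝓝 y, toComplex hn (c'.chart z) * (γ * toComplex hn (c.chart z) + δ) =
      α * toComplex hn (c.chart z) + β) :
    Real.exp (-(c.factor y - c'.factor y)) =
      ‖α * δ - β * γ‖⁻¹ * ‖γ * toComplex hn (c.chart y) + δ‖ ^ 2 := by
  set p := c.chart y with hp
  have hpt : p ∈ c.chart.target := c.chart.map_source hy
  have hyp : c.chart.symm p = y := c.chart.left_inv hy
  set T := toComplexL hn
  set F : EuclideanSpace ℝ (Fin n) → EuclideanSpace ℝ (Fin n) := c'.chart ∘ c.chart.symm with hF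
  have hdF : MDifferentiableAt (𝓡 n) (𝓡 n) F p := by
    refine MDifferentiableAt.comp p ?_ ((c.contMDiffAt_chart_symm hpt).mdifferentiableAt (by simp))
    rw [hyp]
    exact (c'.contMDiffAt_chart hy').mdifferentiableAt (by simp)
  have hdF' := hdF.differentiableAt.hasFDerivAt
  have hev : ∀ᶠ q in 𝓝 p, T (F q) * (γ * T q + δ) = α * T q + β := by
    have h1 : Filter.Tendsto c.chart.symm (𝓝 p) (𝓝 y) := by
      have := c.chart.symm.continuousAt (x := p) hpt
      rwa [ContinuousAt, hyp] at this
    filter_upwards [h1.eventually h, c.chart.open_target.mem_nhds hpt] with q h2 h3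
    rw [c.chart.right_inv h3] at h2
    exact h2
  have hT : ∀ q, HasFDerivAt T T q := fun q ↦ T.hasFDerivAt
  have hderiv := (((hT (F p)).comp p hdF').mul (((hT p).const_mul γ).add_const δ)).unique
    ((((hT p).const_mul α).add_const β).congr_of_eventuallyEq hev)
  obtain ⟨e, he⟩ : ∃ e : EuclideanSpace ℝ (Fin n), e ≠ 0 := by
    subst hn
    exact exists_ne 0
  set v := c.field (fun _ ↦ e) y
  have hv : mfderiv (𝓡 n) (𝓡 n) c.chart y v = e := c.mfderiv_field hy _
  obtain ⟨e', he'⟩ : ∃ e' : EuclideanSpace ℝ (Fin n),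
    mfderiv (𝓡 n) (𝓡 n) c'.chart y v = e' := ⟨_, rfl⟩
  have hFe : fderiv ℝ F p e = e' := by
    have h1 : c'.chart =ᶠ[𝓝 y] F ∘ c.chart :=
      (c.eventually_mem_source hy).mono fun z hz ↦ by
        rw [hF, Function.comp_apply, Function.comp_apply, c.chart.left_inv hz]
    have h2 : fderiv ℝ F p e = mfderiv (𝓡 n) (𝓡 n) F p (mfderiv (𝓡 n) (𝓡 n) c.chart y v) := by
      rw [hv, mfderiv_eq_fderiv]
      rfl
    rw [h2, ← he']
    exact (mfderiv_comp_apply y hdF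
      ((c.contMDiffAt_chart hy).mdifferentiableAt (by simp)) v).symm.trans
      (congrArg (fun L : TangentSpace (𝓡 n) y →L[ℝ] EuclideanSpace ℝ (Fin n) ↦ L v)
        h1.symm.mfderiv_eq)
  have hpt0 := hev.self_of_nhds
  have hmul : T e' * (γ * T p + δ) ^ 2 = (α * δ - β * γ) * T e := by
    have h1 := congrArg (fun L ↦ L e) hderiv
    simp [hFe] at h1
    linear_combination (γ * T p + δ) * h1 - γ * T e * hpt0
  have hnorm : ‖e'‖ * ‖γ * T p + δ‖ ^ 2 = ‖α * δ - β * γ‖ * ‖e‖ := by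
    have h1 := congrArg norm hmul
    rw [norm_mul, norm_mul, norm_pow] at h1
    simpa only [T, toComplexL_apply, norm_toComplex] using h1
  have hi : Real.exp (c.factor y) * ‖e‖ = Real.exp (c'.factor y) * ‖e'‖ := by
    have h1 := (c.conformal y hy v v).symm.trans (c'.conformal y hy' v v)
    have h2 : Real.exp (2 * c.factor y) * ‖e‖ ^ 2 = Real.exp (2 * c'.factor y) * ‖e'‖ ^ 2 := by
      rw [← real_inner_self_eq_norm_sq, ← real_inner_self_eq_norm_sq, ← hv, ← he']
      exact h1
    rw [two_mul, two_mul, Real.exp_add, Real.exp_add] at h2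
    refine (sq_eq_sq₀ (by positivity) (by positivity)).1 ?_
    linear_combination h2
  have hD : ‖α * δ - β * γ‖ ≠ 0 := norm_ne_zero_iff.2 hdet
  have he0 : ‖e‖ ≠ 0 := norm_ne_zero_iff.2 he
  change _ = _ * ‖γ * T p + δ‖ ^ 2
  rw [neg_sub, Real.exp_sub, div_eq_iff (Real.exp_pos _).ne', inv_mul_eq_div,
    div_mul_eq_mul_div, eq_div_iff hD]
  refine mul_right_cancel₀ he0 ?_
  linear_combination -Real.exp (c'.factor y) * hnorm - ‖γ * T p + δ‖ ^ 2 * hi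

/-- Two conformal charts of a surface related by a Möbius transformation define the same tensor. -/
theorem schoutenAt_eq_of_mobius (hn : n = 2) (c' : ConformalChart n M) {x : M}
    (hx : x ∈ c.chart.source) (hx' : x ∈ c'.chart.source) {α β γ δ : ℂ}
    (hdet : α * δ - β * γ ≠ 0)
    (h : ∀ᶠ z in 𝓝 x, toComplex hn (c'.chart z) * (γ * toComplex hn (c.chart z) + δ) =
      α * toComplex hn (c.chart z) + β) (v w : TangentSpace (𝓡 n) x) :
    c.schoutenAt x v w = c'.schoutenAt x v w := by
  have hpt : c.chart x ∈ c.chart.target := c.chart.map_source hx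
  have hxp : c.chart.symm (c.chart x) = x := c.chart.left_inv hx
  set W : EuclideanSpace ℝ (Fin n) → ℝ :=
    fun q ↦ c.factor (c.chart.symm q) - c'.factor (c.chart.symm q) with hWdef
  have hW : ContDiffAt ℝ ∞ W (c.chart x) := by
    refine (c.contDiffAt_expr hx).sub (contMDiffAt_iff_contDiffAt.1 ?_)
    refine ContMDiffAt.comp (c.chart x) ?_ (c.contMDiffAt_chart_symm hpt)
    rw [hxp]
    exact c'.contMDiffOn_factor.contMDiffAt (c'.eventually_mem_source hx')
  have hcW : ∀ᶠ y in 𝓝 x, c.factor y - c'.factor y = W (c.chart y) :=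
    (c.eventually_mem_source hx).mono fun y hy ↦ by
      rw [hWdef]
      simp only
      rw [c.chart.left_inv hy]
  set L : EuclideanSpace ℝ (Fin n) →L[ℝ] ℂ :=
    (ContinuousLinearMap.mul ℝ ℂ γ).comp (toComplexL hn)
  have hQ : ∀ᶠ q in 𝓝 (c.chart x), Real.exp (-W q) = ‖α * δ - β * γ‖⁻¹ * ‖L q + δ‖ ^ 2 := by
    have h1 : Filter.Tendsto c.chart.symm (𝓝 (c.chart x)) (𝓝 x) := by
      have := c.chart.symm.continuousAt (x := c.chart x) hpt
      rwa [ContinuousAt, hxp] at this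
    filter_upwards [h1.eventually h.eventually_nhds,
      h1.eventually (c'.eventually_mem_source hx'), c.chart.open_target.mem_nhds hpt]
      with q h2 h3 h4
    have h5 := c.exp_factor_sub_of_mobius hn c' (c.chart.map_target h4) h3 hdet h2
    rw [c.chart.right_inv h4] at h5
    exact h5
  have hL : ∀ a b, inner ℝ (L a) (L b) = ‖γ‖ ^ 2 * inner ℝ a b := by
    intro a b
    rw [← inner_toComplex hn]
    have h1 : ∀ z z' : ℂ, inner ℝ (γ * z) (γ * z') = ‖γ‖ ^ 2 * inner ℝ z z' := by
      intro z z'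
      rw [Complex.sq_norm, Complex.normSq_apply, Complex.inner, Complex.inner]
      simp
      ring
    exact h1 _ _
  obtain ⟨μ, hμ⟩ := c.exists_schoutenAt_sub_eq c' hx hx' hW hcW
  obtain ⟨ν, hν⟩ : ∃ ν : ℝ, ∀ v w : TangentSpace (𝓡 n) x,
      c.schoutenAt x v w - c'.schoutenAt x v w = ν * inner ℝ v w := by
    refine ⟨-(Real.exp (W (c.chart x)) * (2 * ‖α * δ - β * γ‖⁻¹ * ‖γ‖ ^ 2)) *
      (Real.exp (2 * c.factor x))⁻¹ + μ, fun v w ↦ ?_⟩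
    obtain ⟨a, ha⟩ : ∃ a : EuclideanSpace ℝ (Fin n),
      mfderiv (𝓡 n) (𝓡 n) c.chart x v = a := ⟨_, rfl⟩
    obtain ⟨b, hb⟩ : ∃ b : EuclideanSpace ℝ (Fin n),
      mfderiv (𝓡 n) (𝓡 n) c.chart x w = b := ⟨_, rfl⟩
    have h1 : (Real.exp (2 * c.factor x))⁻¹ * inner ℝ v w = inner ℝ a b := by
      rw [c.conformal x hx v w, inv_mul_cancel_left₀ (Real.exp_pos _).ne', ← ha, ← hb]
      rfl
    rw [hμ, ha, hb, fderiv_fderiv_sub_of_exp_neg hW hQ, fderiv_fderiv_norm_sq, hL, ← h1]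
    ring
  have hS := (c.scalarCurvature_eq hx).symm.trans (c'.scalarCurvature_eq hx')
  have htr : metricTrace (𝓡 n) x (c.schoutenAt x) - metricTrace (𝓡 n) x (c'.schoutenAt x) =
      ν * n := by
    rw [← metricTrace_inner (n := n) x]
    simp only [metricTrace]
    rw [← Finset.sum_sub_distrib, Finset.mul_sum]
    exact Finset.sum_congr rfl fun i _ ↦ hν _ _
  have hn' : (n : ℝ) = 2 := by exact_mod_cast hn
  rw [hn'] at hS htr
  have hν0 : ν = 0 := by linarith
  have := hν v w
  rw [hν0] at this
  linarith

end ConformalChart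

end Charts

end ConformallyFlat

theorem theorem4p4 (n : ℕ) (M : Type*) [TopologicalSpace M]
    [ChartedSpace (EuclideanSpace ℝ (Fin n)) M] [IsManifold (𝓡 n) ∞ M]
    [Bundle.RiemannianBundle (fun x : M ↦ TangentSpace (𝓡 n) x)]
    [IsContMDiffRiemannianBundle (𝓡 n) ∞ (EuclideanSpace ℝ (Fin n))
      (fun x : M ↦ TangentSpace (𝓡 n) x)]
    (B : Π x : M, TangentSpace (𝓡 n) x →L[ℝ] TangentSpace (𝓡 n) x) :
    (3 ≤ n → ConformallyFlat.IsLocallyConformallyFlat n M →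
      ConformallyFlat.IsShapeOperatorAtInfinity Set.univ B →
      ConformallyFlat.SolvesCodazzi (𝓡 n) B) ∧
    (∀ hn : n = 2, ∀ A : Set (ConformallyFlat.ConformalChart n M),
      ConformallyFlat.IsComplexProjectiveAtlas hn A →
      ConformallyFlat.IsShapeOperatorAtInfinity A B →
      ConformallyFlat.SolvesCodazzi (𝓡 n) B) := by
  refine ⟨fun hn hflat hB ↦ ConformallyFlat.solvesCodazzi_of_inner_eq fun x ↦ ?_,
    fun hn A hA hB ↦ ConformallyFlat.solvesCodazzi_of_inner_eq fun x ↦ ?_⟩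
  · obtain ⟨c, hx⟩ := hflat x
    exact ⟨c, hx, fun y hy v w ↦ hB.inner_eq (by omega)
      (fun c _ c' _ x hx hx' ↦ c.schoutenAt_eq_of_three_le hn c' hx hx') (Set.mem_univ c) hy v w⟩
  · obtain ⟨c, hc, hx⟩ := hA.cover x
    refine ⟨c, hx, fun y hy v w ↦ hB.inner_eq (by omega)
      (fun c hc c' hc' x hx hx' ↦ ?_) hc hy v w⟩
    obtain ⟨α, β, γ, δ, hdet, h⟩ := hA.transition c hc c' hc' x ⟨hx, hx'⟩
    exact c.schoutenAt_eq_of_mobius hn c' hx hx' hdet h
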